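/- **Conventions.** For a monoid $M$, $\mathcal{R}M$ is the set of regular subsets of $M$: the least family of subsets that contains the finite sets and is closed under union, elementwise product and iteration $A^*=\bigcup_{n\in\mathbb N}A^n$. A dioid is an idempotent semiring, ordered by $a\le b\iff a+b=b$; for a dioid $D$, $\mathcal{R}D$ refers to its multiplicative monoid. An $\mathcal{R}$-dioid (equivalently, a $*$-continuous Kleene algebra) is a dioid $K$ in which every $A\in\mathcal{R}K$ has a least upper bound $\sum A$, and $\sum(AB)=(\sum A)(\sum B)$ for all $A,B\in\mathcal{R}K$; one puts $c^*:=\sum\{c\}^*$. For a monoid $M$, $\mathcal{R}M$ is an $\mathcal{R}$-dioid under union and elementwise product. An $\mathcal{R}$-congruence on an $\mathcal{R}$-dioid $D$ is a semiring congruence $\rho$ such that for all $U,U'\in\mathcal{R}D$, if $\{d/\rho: d\in U\}$ and $\{d/\rho : d\in U'\}$ have the same downward closure in $D/\rho$, then $(\sum U)/\rho=(\sum U')/\rho$. Every relation on $D$ generates a least $\mathcal{R}$-congruence, and the quotient is again an $\mathcal{R}$-dioid. Let $\Delta_2=\{b,p\}\cup\{d,q\}$ consist of two opening brackets $b=p_0$,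 $p=p_1$ and two closing brackets $d=q_0$, $q=q_1$. The polycyclic $\mathcal{R}$-dioid $C_2'$ is the quotient of $\mathcal{R}(\Delta_2^*)$ by the $\mathcal{R}$-congruence generated by the equations $p_iq_j=\delta_{i,j}$ $(i,j<2)$, i.e. $bd=pq=1$, $bq=pd=0$. The tensor product $K\otimes_{\mathcal R}C$ of $\mathcal{R}$-dioids $K$ and $C$ is the quotient of $\mathcal{R}(K\times C)$ (for the product of the multiplicative monoids) by the $\mathcal{R}$-congruence generated by the equations $A\times B=\{(\sum A,\sum B)\}$ for $A\in\mathcal{R}K$, $B\in\mathcal{R}C$. Elements $k\in K$ and $c\in C$ are read in $K\otimes_{\mathcal R}C$ as the classes of $\{(k,1)\}$ and $\{(1,c)\}$. Let $Z$ be the set of all elements of $K\otimes_{\mathcal R}C_2'$ that commute with (the image of) every $c\in C_2'$. For an $\mathcal{R}$-dioid $L$, the $n\times n$-matrices over $L$ form a Kleene algebra $\mathrm{Mat}_{n,n}(L)$ with the usual sum and product (so the order is entrywise), and iteration given by $(k)^*=(k^*)$ for $n=1$ and $$\begin{pmatrix}A&B\\C&D\end{pmatrix}^*=\begin{pmatrix}F^*&F^*BD^*\\D^*CF^*&D^*CF^*BD^*+D^*\end{pmatrix},\qquad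 F=A+BD^*C,$$ for any splitting into blocks with $A,D$ square. **Theorem (First Normal Form).** Let $K$ be an $\mathcal{R}$-dioid. For every $\varphi\in K\otimes_{\mathcal R}C_2'$ there are $n\in\mathbb N$, boolean vectors $S\in\{0,1\}^{1\times n}$ and $F\in\{0,1\}^{n\times 1}$, and matrices $U\in\{0,b,p\}^{n\times n}$, $V\in\{0,d,q\}^{n\times n}$ and $X\in K^{n\times n}$ such that the inequation $$y\ \ge\ (UyV+X)^*$$ has a least solution $N$ in $\mathrm{Mat}_{n,n}(K\otimes_{\mathcal R}C_2')$, all entries of $N$ belong to $Z$, and $$\varphi\ =\ S\,(NV)^*\,N\,(UN)^*\,F .$$ -/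

import Mathlib

open scoped Pointwise

/-! ## Regular sets and `ℛ`-dioids -/

/-- The regular subsets of a monoid: the least family that contains the finite sets and is closed
under union, product and iteration `A* = ⋃ₙ Aⁿ`. -/
inductive IsRegularSet {M : Type*} [Monoid M] : Set M → Prop
  | empty : IsRegularSet ∅
  | singleton (m : M) : IsRegularSet {m}
  | union (A B : Set M) : IsRegularSet A → IsRegularSet B → IsRegularSet (A ∪ B)
  | mul (A B : Set M) : IsRegularSet A → IsRegularSet B → IsRegularSet (A * B)
  | star (A : Set M) : IsRegularSet A → IsRegularSet (⋃ n : ℕ, A ^ n)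

/-- An `ℛ`-dioid: an idempotent semiring (dioid) in which every regular subset of the
multiplicative monoid has a least upper bound, and `∑ (A B) = (∑ A) (∑ B)` for regular `A`, `B`.
The order is the natural one, `a ≤ b ↔ a + b = b`. -/
class RDioid (K : Type*) extends IdemSemiring K where
  exists_isLUB : ∀ A : Set K, IsRegularSet A → ∃ s, IsLUB A s
  isLUB_mul : ∀ A B : Set K, IsRegularSet A → IsRegularSet B →
    ∀ s t, IsLUB A s → IsLUB B t → IsLUB (A * B) (s * t)

section RDioidStar

variable {K : Type*} [RDioid K]

/-- `c* = ∑ {c}*`. -/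
noncomputable def RDioid.star (c : K) : K :=
  Classical.choose (RDioid.exists_isLUB _ (IsRegularSet.star _ (IsRegularSet.singleton c)))

theorem RDioid.isLUB_star (c : K) : IsLUB (⋃ n : ℕ, ({c} : Set K) ^ n) (RDioid.star c) :=
  Classical.choose_spec (RDioid.exists_isLUB _ (IsRegularSet.star _ (IsRegularSet.singleton c)))

theorem RDioid.mem_powers (c x : K) :
    x ∈ (⋃ n : ℕ, ({c} : Set K) ^ n) ↔ ∃ n : ℕ, x = c ^ n := by
  simp [Set.singleton_pow, eq_comm]

theorem RDioid.isLUB_mul_star_mul (a b c : K) :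
    IsLUB {x | ∃ n : ℕ, x = a * c ^ n * b} (a * RDioid.star c * b) := by
  have h1 := RDioid.isLUB_mul _ _ (IsRegularSet.singleton a)
    (IsRegularSet.star _ (IsRegularSet.singleton c)) _ _ isLUB_singleton (RDioid.isLUB_star c)
  have h2 := RDioid.isLUB_mul _ _ (IsRegularSet.mul _ _ (IsRegularSet.singleton a)
    (IsRegularSet.star _ (IsRegularSet.singleton c))) (IsRegularSet.singleton b) _ _ h1
    isLUB_singleton
  convert h2 using 1
  ext x
  simp only [Set.singleton_mul, Set.mul_singleton, Set.mem_image, RDioid.mem_powers,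
    Set.mem_ofPred_eq]
  constructor
  · rintro ⟨n, rfl⟩
    exact ⟨a * c ^ n, ⟨c ^ n, ⟨n, rfl⟩, rfl⟩, rfl⟩
  · rintro ⟨_, ⟨_, ⟨n, rfl⟩, rfl⟩, rfl⟩
    exact ⟨n, rfl⟩

/-- Every `ℛ`-dioid is a Kleene algebra (and a `*`-continuous one) with `c* = ∑ {c}*`. -/
noncomputable instance RDioid.toKleeneAlgebra : KleeneAlgebra K where
  kstar := RDioid.star
  one_le_kstar c := (RDioid.isLUB_star c).1 ((RDioid.mem_powers c _).2 ⟨0, (pow_zero c).symm⟩)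
  mul_kstar_le_kstar c := by
    have h := RDioid.isLUB_mul_star_mul c 1 c
    rw [mul_one] at h
    refine h.2 ?_
    rintro _ ⟨n, rfl⟩
    exact (RDioid.isLUB_star c).1 ((RDioid.mem_powers c _).2 ⟨n + 1, by rw [mul_one, pow_succ']⟩)
  kstar_mul_le_kstar c := by
    have h := RDioid.isLUB_mul_star_mul 1 c c
    rw [one_mul] at h
    refine h.2 ?_
    rintro _ ⟨n, rfl⟩
    exact (RDioid.isLUB_star c).1 ((RDioid.mem_powers c _).2 ⟨n + 1, by rw [one_mul, pow_succ]⟩)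
  mul_kstar_le_self a b hab := by
    have h := RDioid.isLUB_mul_star_mul b 1 a
    rw [mul_one] at h
    refine h.2 ?_
    rintro _ ⟨n, rfl⟩
    rw [mul_one]
    induction n with
    | zero => simp
    | succ n ih =>
      rw [pow_succ, ← mul_assoc]
      exact (mul_le_mul_left ih a).trans hab
  kstar_mul_le_self a b hab := by
    have h := RDioid.isLUB_mul_star_mul 1 b a
    rw [one_mul] at h
    refine h.2 ?_
    rintro _ ⟨n, rfl⟩
    rw [one_mul]
    induction n with
    | zero => simp
    | succ n ih =>
      rw [pow_succ', mul_assoc]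
      exact (mul_le_mul_right ih a).trans hab

end RDioidStar

/-! ## The `ℛ`-dioid of regular subsets of a monoid -/

/-- `ℛM`, the set of regular subsets of the monoid `M`. -/
def RegSet (M : Type*) [Monoid M] : Type _ := {A : Set M // IsRegularSet A}

section RegSet

variable {M : Type*} [Monoid M]

/-- `ℛM` as an idempotent semiring: addition is union, multiplication is the elementwise product,
`0 = ∅`, `1 = {1}`, and the order is inclusion. -/
instance RegSet.idemSemiring : IdemSemiring (RegSet M) where
  add A B := ⟨A.1 ∪ B.1, .union _ _ A.2 B.2⟩
  zero := ⟨∅, .empty⟩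
  mul A B := ⟨A.1 * B.1, .mul _ _ A.2 B.2⟩
  one := ⟨{1}, .singleton 1⟩
  add_assoc A B C := Subtype.ext (Set.union_assoc A.1 B.1 C.1)
  zero_add A := Subtype.ext (Set.empty_union A.1)
  add_zero A := Subtype.ext (Set.union_empty A.1)
  add_comm A B := Subtype.ext (Set.union_comm A.1 B.1)
  nsmul := @nsmulRec _ ⟨⟨∅, .empty⟩⟩ ⟨fun A B => ⟨A.1 ∪ B.1, .union _ _ A.2 B.2⟩⟩
  left_distrib A B C := Subtype.ext (Set.mul_union (s := A.1) (t₁ := B.1) (t₂ := C.1))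
  right_distrib A B C := Subtype.ext (Set.union_mul (s₁ := A.1) (s₂ := B.1) (t := C.1))
  zero_mul A := Subtype.ext (Set.empty_mul (s := A.1))
  mul_zero A := Subtype.ext (Set.mul_empty (s := A.1))
  mul_assoc A B C := Subtype.ext (mul_assoc A.1 B.1 C.1)
  one_mul A := Subtype.ext (one_mul A.1)
  mul_one A := Subtype.ext (mul_one A.1)
  le A B := A.1 ⊆ B.1
  le_refl A := Set.Subset.refl A.1
  le_trans _ _ _ h₁ h₂ := Set.Subset.trans h₁ h₂
  le_antisymm _ _ h₁ h₂ := Subtype.ext (Set.Subset.antisymm h₁ h₂)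
  sup A B := ⟨A.1 ∪ B.1, .union _ _ A.2 B.2⟩
  le_sup_left A B := Set.subset_union_left (s := A.1) (t := B.1)
  le_sup_right A B := Set.subset_union_right (s := A.1) (t := B.1)
  sup_le _ _ _ h₁ h₂ := Set.union_subset h₁ h₂
  bot := ⟨∅, .empty⟩
  bot_le A := Set.empty_subset A.1

/-- The union of a set of regular sets. -/
def RegSet.union (U : Set (RegSet M)) : Set M := {m | ∃ A ∈ U, m ∈ A.1}

theorem RegSet.union_mul (U V : Set (RegSet M)) :
    RegSet.union (U * V) = RegSet.union U * RegSet.union V := by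
  ext m
  constructor
  · rintro ⟨_, ⟨A, hA, B, hB, rfl⟩, ⟨a, ha, b, hb, rfl⟩⟩
    exact ⟨a, ⟨A, hA, ha⟩, b, ⟨B, hB, hb⟩, rfl⟩
  · rintro ⟨a, ⟨A, hA, ha⟩, b, ⟨B, hB, hb⟩, rfl⟩
    exact ⟨A * B, ⟨A, hA, B, hB, rfl⟩, ⟨a, ha, b, hb, rfl⟩⟩

theorem RegSet.union_one : RegSet.union (1 : Set (RegSet M)) = 1 := by
  ext m
  constructor
  · rintro ⟨A, hA, hm⟩
    rw [Set.mem_one] at hA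
    subst hA
    exact hm
  · intro hm
    exact ⟨1, Set.mem_one.2 rfl, hm⟩

theorem RegSet.union_pow (U : Set (RegSet M)) (n : ℕ) :
    RegSet.union (U ^ n) = RegSet.union U ^ n := by
  induction n with
  | zero => simpa using RegSet.union_one
  | succ n ih => rw [pow_succ, pow_succ, RegSet.union_mul, ih]

theorem RegSet.isRegularSet_union (U : Set (RegSet M)) (hU : IsRegularSet U) :
    IsRegularSet (RegSet.union U) := by
  induction hU with
  | empty =>
    have : RegSet.union (∅ : Set (RegSet M)) = ∅ := by ext; simp [RegSet.union]
    rw [this]; exact .empty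
  | singleton A =>
    have : RegSet.union ({A} : Set (RegSet M)) = A.1 := by ext; simp [RegSet.union]
    rw [this]; exact A.2
  | union U V _ _ h₁ h₂ =>
    have : RegSet.union (U ∪ V) = RegSet.union U ∪ RegSet.union V := by
      ext m
      simp only [RegSet.union, Set.mem_union, Set.mem_ofPred_eq, or_and_right, exists_or]
    rw [this]; exact .union _ _ h₁ h₂
  | mul U V _ _ h₁ h₂ => rw [RegSet.union_mul]; exact .mul _ _ h₁ h₂
  | star U _ h =>
    have : RegSet.union (⋃ n : ℕ, U ^ n) = ⋃ n : ℕ, RegSet.union U ^ n := by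
      ext m
      simp only [← RegSet.union_pow, Set.mem_iUnion]
      constructor
      · rintro ⟨A, hA, hm⟩
        obtain ⟨n, hA⟩ := Set.mem_iUnion.1 hA
        exact ⟨n, A, hA, hm⟩
      · rintro ⟨n, A, hA, hm⟩
        exact ⟨A, Set.mem_iUnion.2 ⟨n, hA⟩, hm⟩
    rw [this]; exact .star _ h

/-- The sum of a regular set of regular sets, which is its union. -/
def RegSet.sum (U : Set (RegSet M)) (hU : IsRegularSet U) : RegSet M :=
  ⟨RegSet.union U, RegSet.isRegularSet_union U hU⟩

theorem RegSet.isLUB_sum (U : Set (RegSet M)) (hU : IsRegularSet U) :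
    IsLUB U (RegSet.sum U hU) := by
  constructor
  · intro A hA m hm
    exact ⟨A, hA, hm⟩
  · rintro B hB m ⟨A, hA, hm⟩
    exact hB hA hm

/-- `ℛM` is an `ℛ`-dioid; least upper bounds of regular sets of regular sets are unions. -/
instance RegSet.rdioid : RDioid (RegSet M) where
  exists_isLUB U hU := ⟨_, RegSet.isLUB_sum U hU⟩
  isLUB_mul U V hU hV s t hs ht := by
    rw [hs.unique (RegSet.isLUB_sum U hU), ht.unique (RegSet.isLUB_sum V hV)]
    have h : RegSet.sum (U * V) (.mul _ _ hU hV) = RegSet.sum U hU * RegSet.sum V hV :=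
      Subtype.ext (RegSet.union_mul U V)
    rw [← h]
    exact RegSet.isLUB_sum (U * V) (.mul _ _ hU hV)

end RegSet

/-! ## `ℛ`-congruences and quotients -/

section Congruence

/-- The quotient of a dioid by a dioid congruence (a congruence for `+` and `*`) is a dioid,
ordered by `x ≤ y ↔ x + y = y`. -/
instance quotientIdemSemiring {D : Type*} [IdemSemiring D] (c : RingCon D) :
    IdemSemiring c.Quotient :=
  IdemSemiring.ofSemiring (by
    intro x
    induction x using Quotient.inductionOn'
    rename_i a
    exact congrArg (RingCon.toQuotient (c := c)) (add_idem a))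

/-- `(U/ρ)↓ = {e/ρ | e/ρ ≤ d/ρ for some d ∈ U}`. -/
def RingCon.downSet {D : Type*} [IdemSemiring D] (c : RingCon D) (U : Set D) : Set c.Quotient :=
  {x | ∃ d ∈ U, x ≤ (d : c.Quotient)}

/-- An `ℛ`-congruence: a dioid congruence `ρ` such that `(∑ U)/ρ = (∑ U')/ρ` for all regular
`U`, `U'` with `(U/ρ)↓ = (U'/ρ)↓`. -/
def RingCon.IsRCongruence {D : Type*} [RDioid D] (c : RingCon D) : Prop :=
  ∀ U U' : Set D, IsRegularSet U → IsRegularSet U' → c.downSet U = c.downSet U' →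
    ∀ s s' : D, IsLUB U s → IsLUB U' s' → c s s'

/-- The least `ℛ`-congruence on `D` containing `r`: the intersection of all of them. -/
def rCongruenceGen {D : Type*} [RDioid D] (r : D → D → Prop) : RingCon D :=
  sInf {c : RingCon D | c.IsRCongruence ∧ ∀ a b, r a b → c a b}

theorem RingCon.coe_le_coe {D : Type*} [IdemSemiring D] (c : RingCon D) (a b : D) :
    (a : c.Quotient) ≤ (b : c.Quotient) ↔ c (a + b) b :=
  c.eq (a := a + b) (b := b)

theorem RingCon.downSet_subset_iff {D : Type*} [IdemSemiring D] (c : RingCon D) (U U' : Set D) :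
    c.downSet U ⊆ c.downSet U' ↔ ∀ d ∈ U, ∃ d' ∈ U', c (d + d') d' := by
  constructor
  · intro h d hd
    obtain ⟨d', hd', h'⟩ := h (⟨d, hd, le_rfl⟩ : (d : c.Quotient) ∈ c.downSet U)
    exact ⟨d', hd', (c.coe_le_coe d d').1 h'⟩
  · rintro h x ⟨d, hd, hx⟩
    obtain ⟨d', hd', h'⟩ := h d hd
    exact ⟨d', hd', hx.trans ((c.coe_le_coe d d').2 h')⟩

theorem rCongruenceGen_iff {D : Type*} [RDioid D] (r : D → D → Prop) (x y : D) :
    rCongruenceGen r x y ↔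
      ∀ c : RingCon D, c.IsRCongruence → (∀ a b, r a b → c a b) → c x y := by
  refine ⟨fun h c h₁ h₂ => h c ⟨h₁, h₂⟩, fun h c hc => h c hc.1 hc.2⟩

theorem rCongruenceGen_of {D : Type*} [RDioid D] (r : D → D → Prop) (x y : D) (h : r x y) :
    rCongruenceGen r x y :=
  (rCongruenceGen_iff r x y).2 fun _ _ h₂ => h₂ x y h

theorem isRCongruence_rCongruenceGen {D : Type*} [RDioid D] (r : D → D → Prop) :
    (rCongruenceGen r).IsRCongruence := by
  intro U U' hU hU' h s s' hs hs'
  rw [rCongruenceGen_iff]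
  intro c h₁ h₂
  have key : ∀ V V' : Set D, (rCongruenceGen r).downSet V ⊆ (rCongruenceGen r).downSet V' →
      c.downSet V ⊆ c.downSet V' := by
    intro V V' hV
    rw [RingCon.downSet_subset_iff] at hV ⊢
    intro d hd
    obtain ⟨d', hd', h'⟩ := hV d hd
    exact ⟨d', hd', (rCongruenceGen_iff r _ _).1 h' c h₁ h₂⟩
  exact h₁ U U' hU hU' (Set.Subset.antisymm (key _ _ h.subset) (key _ _ h.symm.subset)) s s' hs hs'

/-- The quotient of `D` by the `ℛ`-congruence generated by the relation `r`. -/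
def RQuotient {D : Type*} [RDioid D] (r : D → D → Prop) : Type _ := (rCongruenceGen r).Quotient

section RQuotient

variable {D : Type*} [RDioid D] (r : D → D → Prop)

instance RQuotient.idemSemiring : IdemSemiring (RQuotient r) :=
  quotientIdemSemiring (rCongruenceGen r)

/-- The quotient map, as a semiring homomorphism. -/
def RQuotient.mk : D →+* RQuotient r := (rCongruenceGen r).mk'

theorem RQuotient.mk_surjective : Function.Surjective (RQuotient.mk r) :=
  (rCongruenceGen r).mk'_surjective

theorem RQuotient.exists_lift (U : Set (RQuotient r)) (hU : IsRegularSet U) :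
    ∃ V : Set D, IsRegularSet V ∧ RQuotient.mk r '' V = U := by
  induction hU with
  | empty => exact ⟨∅, .empty, Set.image_empty _⟩
  | singleton x =>
    obtain ⟨d, rfl⟩ := RQuotient.mk_surjective r x
    exact ⟨{d}, .singleton d, Set.image_singleton⟩
  | union _ _ _ _ h₁ h₂ =>
    obtain ⟨V₁, hV₁, rfl⟩ := h₁
    obtain ⟨V₂, hV₂, rfl⟩ := h₂
    exact ⟨V₁ ∪ V₂, .union _ _ hV₁ hV₂, Set.image_union _ _ _⟩
  | mul _ _ _ _ h₁ h₂ =>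
    obtain ⟨V₁, hV₁, rfl⟩ := h₁
    obtain ⟨V₂, hV₂, rfl⟩ := h₂
    exact ⟨V₁ * V₂, .mul _ _ hV₁ hV₂, Set.image_mul _⟩
  | star _ _ h =>
    obtain ⟨V, hV, rfl⟩ := h
    refine ⟨⋃ n : ℕ, V ^ n, .star _ hV, ?_⟩
    rw [Set.image_iUnion]
    exact Set.iUnion_congr fun n => Set.image_pow _ _ _

theorem RQuotient.isLUB_image (V : Set D) (hV : IsRegularSet V) (s : D) (hs : IsLUB V s) :
    IsLUB (RQuotient.mk r '' V) (RQuotient.mk r s) := by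
  have hle : ∀ a b : D, RQuotient.mk r a ≤ RQuotient.mk r b ↔ rCongruenceGen r (a + b) b :=
    (rCongruenceGen r).coe_le_coe
  constructor
  · rintro _ ⟨d, hd, rfl⟩
    rw [hle, (hs.1 hd).add_eq_right]
    exact (rCongruenceGen r).refl s
  · intro x hx
    obtain ⟨e, rfl⟩ := RQuotient.mk_surjective r x
    have hlub : IsLUB (V ∪ {e}) (s + e) := by
      rw [add_eq_sup]; exact hs.union isLUB_singleton
    rw [hle]
    refine isRCongruence_rCongruenceGen r (V ∪ {e}) {e} (.union _ _ hV (.singleton e))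
      (.singleton e) ?_ _ _ hlub isLUB_singleton
    apply Set.Subset.antisymm
    · rw [RingCon.downSet_subset_iff]
      rintro d (hd | hd)
      · exact ⟨e, rfl, (hle d e).1 (hx ⟨d, hd, rfl⟩)⟩
      · exact ⟨e, rfl, (hle d e).1 (by rw [Set.mem_singleton_iff.1 hd])⟩
    · rintro y ⟨d, hd, hy⟩
      exact ⟨d, Or.inr hd, hy⟩

/-- The quotient of an `ℛ`-dioid by an `ℛ`-congruence is an `ℛ`-dioid. -/
instance RQuotient.rdioid : RDioid (RQuotient r) where
  exists_isLUB U hU := by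
    obtain ⟨V, hV, rfl⟩ := RQuotient.exists_lift r U hU
    obtain ⟨s, hs⟩ := RDioid.exists_isLUB V hV
    exact ⟨_, RQuotient.isLUB_image r V hV s hs⟩
  isLUB_mul U₁ U₂ h₁ h₂ s t hs ht := by
    obtain ⟨V₁, hV₁, rfl⟩ := RQuotient.exists_lift r U₁ h₁
    obtain ⟨V₂, hV₂, rfl⟩ := RQuotient.exists_lift r U₂ h₂
    obtain ⟨v₁, hv₁⟩ := RDioid.exists_isLUB V₁ hV₁
    obtain ⟨v₂, hv₂⟩ := RDioid.exists_isLUB V₂ hV₂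
    rw [hs.unique (RQuotient.isLUB_image r V₁ hV₁ v₁ hv₁),
      ht.unique (RQuotient.isLUB_image r V₂ hV₂ v₂ hv₂), ← map_mul, ← Set.image_mul]
    exact RQuotient.isLUB_image r _ (.mul _ _ hV₁ hV₂) _
      (RDioid.isLUB_mul V₁ V₂ hV₁ hV₂ v₁ v₂ hv₁ hv₂)

end RQuotient

end Congruence

/-! ## The polycyclic `ℛ`-dioids -/

/-- The alphabet `Δₘ` of `m` opening brackets `pᵢ` and `m` closing brackets `qᵢ`. -/
inductive PolyBracket (m : ℕ) : Type
  | opening (i : Fin m) : PolyBracket m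
  | closing (i : Fin m) : PolyBracket m

/-- The class `{w} ∈ ℛM` of an element `w` of the monoid `M`. -/
def RegSet.single {M : Type*} [Monoid M] (w : M) : RegSet M := ⟨{w}, .singleton w⟩

/-- The bracket match and mismatch equations `pᵢ qⱼ = δᵢⱼ`. -/
inductive BracketRel (m : ℕ) :
    RegSet (FreeMonoid (PolyBracket m)) → RegSet (FreeMonoid (PolyBracket m)) → Prop
  | mk (i j : Fin m) : BracketRel m
      (RegSet.single (FreeMonoid.of (.opening i) * FreeMonoid.of (.closing j)))
      (if i = j then 1 else 0)

/-- The polycyclic `ℛ`-dioid `Cₘ'`: the quotient of `ℛ(Δₘ*)` by the `ℛ`-congruence generated by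
the equations `pᵢ qⱼ = δᵢⱼ`. -/
abbrev Polycyclic (m : ℕ) : Type := RQuotient (BracketRel m)

/-- The class of the opening bracket `pᵢ` in `Cₘ'`. -/
def Polycyclic.opening {m : ℕ} (i : Fin m) : Polycyclic m :=
  RQuotient.mk (BracketRel m) (RegSet.single (FreeMonoid.of (.opening i)))

/-- The class of the closing bracket `qᵢ` in `Cₘ'`. -/
def Polycyclic.closing {m : ℕ} (i : Fin m) : Polycyclic m :=
  RQuotient.mk (BracketRel m) (RegSet.single (FreeMonoid.of (.closing i)))

/-! ## The tensor product of `ℛ`-dioids -/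

/-- The tensor product equations `A × B = {(∑ A, ∑ B)}` for regular sets `A` and `B`. -/
def TensorRel (K₁ K₂ : Type*) [RDioid K₁] [RDioid K₂] (R S : RegSet (K₁ × K₂)) : Prop :=
  ∃ (A : Set K₁) (B : Set K₂) (s : K₁) (t : K₂), IsRegularSet A ∧ IsRegularSet B ∧
    IsLUB A s ∧ IsLUB B t ∧ R.1 = A ×ˢ B ∧ S.1 = {(s, t)}

/-- The tensor product `K₁ ⊗_ℛ K₂`: the quotient of `ℛ(K₁ × K₂)`, for the product of the
multiplicative monoids, by the `ℛ`-congruence generated by the tensor product equations. -/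
abbrev RTensor (K₁ K₂ : Type*) [RDioid K₁] [RDioid K₂] : Type _ := RQuotient (TensorRel K₁ K₂)

/-- `⊤₁ : K₁ → K₁ ⊗_ℛ K₂`, `a ↦ [{(a, 1)}]`. -/
def RTensor.inl {K₁ K₂ : Type*} [RDioid K₁] [RDioid K₂] (a : K₁) : RTensor K₁ K₂ :=
  RQuotient.mk (TensorRel K₁ K₂) (RegSet.single (a, 1))

/-- `⊤₂ : K₂ → K₁ ⊗_ℛ K₂`, `b ↦ [{(1, b)}]`. -/
def RTensor.inr {K₁ K₂ : Type*} [RDioid K₁] [RDioid K₂] (b : K₂) : RTensor K₁ K₂ :=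
  RQuotient.mk (TensorRel K₁ K₂) (RegSet.single (1, b))

/-! ## The Kleene algebra of square matrices -/

section MatrixKleene

variable {K : Type*}

/-- Matrices over a dioid are ordered entrywise; this is the natural order of matrix addition. -/
instance matrixPartialOrder {m n : Type*} [IdemSemiring K] : PartialOrder (Matrix m n K) where
  le X Y := ∀ i j, X i j ≤ Y i j
  le_refl _ _ _ := le_rfl
  le_trans _ _ _ h₁ h₂ i j := (h₁ i j).trans (h₂ i j)
  le_antisymm _ _ h₁ h₂ := Matrix.ext fun i j => le_antisymm (h₁ i j) (h₂ i j)

instance matrixIdemSemiring {n : Type*} [Fintype n] [DecidableEq n] [IdemSemiring K] :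
    IdemSemiring (Matrix n n K) where
  __ := (inferInstance : Semiring (Matrix n n K))
  __ := matrixPartialOrder (m := n) (n := n) (K := K)
  sup X Y := X + Y
  le_sup_left _ _ _ _ := (add_le_iff.1 le_rfl).1
  le_sup_right _ _ _ _ := (add_le_iff.1 le_rfl).2
  sup_le _ _ _ h₁ h₂ i j := add_le (h₁ i j) (h₂ i j)
  bot := 0
  bot_le X i j := (bot_le : (⊥ : K) ≤ X i j) |>.trans' (bot_eq_zero (α := K)).ge

/-- The iteration `M*` of a square matrix, by recursion on the dimension: for
`M = (A B; C D)` with `D` of dimension one, `D* = (d*)`, and `F = A + B D* C`, it is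
`M* = (F*  F* B D*; D* C F*  D* C F* B D* + D*)`. -/
noncomputable def matrixStar [RDioid K] :
    (n : ℕ) → Matrix (Fin n) (Fin n) K → Matrix (Fin n) (Fin n) K
  | 0, M => M
  | n + 1, M =>
    let M' : Matrix (Fin n ⊕ Fin 1) (Fin n ⊕ Fin 1) K := M.submatrix finSumFinEquiv finSumFinEquiv
    let A := M'.toBlocks₁₁
    let B := M'.toBlocks₁₂
    let C := M'.toBlocks₂₁
    let Ds := M'.toBlocks₂₂.map KStar.kstar
    let Fs := matrixStar n (A + B * Ds * C)
    (Matrix.fromBlocks Fs (Fs * B * Ds) (Ds * C * Fs) (Ds * C * Fs * B * Ds + Ds)).submatrix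
      finSumFinEquiv.symm finSumFinEquiv.symm

section Order

variable [IdemSemiring K] {l m n : Type*}

theorem matrix_add_le {X Y Z : Matrix m n K} (h₁ : X ≤ Z) (h₂ : Y ≤ Z) : X + Y ≤ Z :=
  fun i j => add_le (h₁ i j) (h₂ i j)

theorem matrix_add_le_iff {X Y Z : Matrix m n K} : X + Y ≤ Z ↔ X ≤ Z ∧ Y ≤ Z :=
  ⟨fun h => ⟨fun i j => (add_le_iff.1 (h i j)).1, fun i j => (add_le_iff.1 (h i j)).2⟩,
    fun h => matrix_add_le h.1 h.2⟩

theorem matrix_mul_mono [Fintype m] {X X' : Matrix l m K} {Y Y' : Matrix m n K}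
    (h₁ : X ≤ X') (h₂ : Y ≤ Y') : X * Y ≤ X' * Y' := fun i j => by
  rw [Matrix.mul_apply, Matrix.mul_apply]
  exact Finset.sum_le_sum fun k _ => mul_le_mul' (h₁ i k) (h₂ k j)

/-- `S` satisfies the Kleene algebra axioms for the iteration of `M`. -/
structure IsMatrixStar [Fintype n] [DecidableEq n] (M S : Matrix n n K) : Prop where
  one_le : 1 ≤ S
  mul_le : M * S ≤ S
  le_mul : S * M ≤ S
  left : ∀ (k : Type) (Y : Matrix n k K), M * Y ≤ Y → S * Y ≤ Y
  right : ∀ (k : Type) (Y : Matrix k n K), Y * M ≤ Y → Y * S ≤ Y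

end Order

theorem isMatrixStar_fromBlocks [IdemSemiring K] {m n : Type} [Fintype m] [DecidableEq m]
    [Fintype n] [DecidableEq n] (A : Matrix m m K) (B : Matrix m n K) (C : Matrix n m K)
    (D : Matrix n n K) (Fs : Matrix m m K) (Ds : Matrix n n K) (hD : IsMatrixStar D Ds)
    (hF : IsMatrixStar (A + B * Ds * C) Fs) :
    IsMatrixStar (Matrix.fromBlocks A B C D)
      (Matrix.fromBlocks Fs (Fs * B * Ds) (Ds * C * Fs) (Ds * C * Fs * B * Ds + Ds)) := by
  have blocks_le : ∀ {p q : Type} (X₁ Y₁ : Matrix m p K) (X₂ Y₂ : Matrix m q K)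
      (X₃ Y₃ : Matrix n p K) (X₄ Y₄ : Matrix n q K), X₁ ≤ Y₁ → X₂ ≤ Y₂ → X₃ ≤ Y₃ → X₄ ≤ Y₄ →
      Matrix.fromBlocks X₁ X₂ X₃ X₄ ≤ Matrix.fromBlocks Y₁ Y₂ Y₃ Y₄ := by
    intro p q X₁ Y₁ X₂ Y₂ X₃ Y₃ X₄ Y₄ h₁ h₂ h₃ h₄ i j
    rcases i with i | i <;> rcases j with j | j
    exacts [h₁ i j, h₂ i j, h₃ i j, h₄ i j]
  have Done := hD.one_le
  have Fone := hF.one_le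
  have F1 := hF.mul_le
  rw [Matrix.add_mul, matrix_add_le_iff] at F1
  have F2 := hF.le_mul
  rw [Matrix.mul_add, matrix_add_le_iff] at F2
  have zle : ∀ {p q : Type} (X : Matrix p q K), 0 ≤ X := fun X i j => zero_le
  have le_one_mul : ∀ {p : Type} (X : Matrix m p K), X ≤ Fs * X := fun X => by
    simpa using matrix_mul_mono Fone (le_refl X)
  have le_mul_one : ∀ {p : Type} (X : Matrix p m K), X ≤ X * Fs := fun X => by
    simpa using matrix_mul_mono (le_refl X) Fone
  have le_one_mul' : ∀ {p : Type} (X : Matrix n p K), X ≤ Ds * X := fun X => by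
    simpa using matrix_mul_mono Done (le_refl X)
  have le_mul_one' : ∀ {p : Type} (X : Matrix p n K), X ≤ X * Ds := fun X => by
    simpa using matrix_mul_mono (le_refl X) Done
  have hadd : ∀ {p q : Type} (X Y : Matrix p q K), X ≤ X + Y ∧ Y ≤ X + Y := fun X Y =>
    matrix_add_le_iff.1 le_rfl
  refine ⟨?_, ?_, ?_, ?_, ?_⟩
  · rw [← Matrix.fromBlocks_one]
    exact blocks_le _ _ _ _ _ _ _ _ Fone (zle _) (zle _) (Done.trans (hadd _ _).2)
  · rw [Matrix.fromBlocks_multiply]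
    refine blocks_le _ _ _ _ _ _ _ _ ?_ ?_ ?_ ?_
    · exact matrix_add_le F1.1 (by simpa only [Matrix.mul_assoc] using F1.2)
    · refine matrix_add_le ?_ ?_
      · simpa only [Matrix.mul_assoc] using matrix_mul_mono F1.1 (le_refl (B * Ds))
      · rw [Matrix.mul_add]
        refine matrix_add_le ?_ ?_
        · simpa only [Matrix.mul_assoc] using matrix_mul_mono F1.2 (le_refl (B * Ds))
        · simpa only [Matrix.mul_assoc] using le_one_mul (B * Ds)
    · refine matrix_add_le ?_ ?_
      · simpa only [Matrix.mul_assoc] using le_one_mul' (C * Fs)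
      · simpa only [Matrix.mul_assoc] using matrix_mul_mono hD.mul_le (le_refl (C * Fs))
    · refine matrix_add_le ?_ ?_
      · refine le_trans ?_ (hadd _ _).1
        simpa only [Matrix.mul_assoc] using le_one_mul' (C * Fs * B * Ds)
      · rw [Matrix.mul_add]
        refine matrix_add_le ?_ (hD.mul_le.trans (hadd _ _).2)
        refine le_trans ?_ (hadd _ _).1
        simpa only [Matrix.mul_assoc] using matrix_mul_mono hD.mul_le (le_refl (C * Fs * B * Ds))
  · rw [Matrix.fromBlocks_multiply]
    refine blocks_le _ _ _ _ _ _ _ _ ?_ ?_ ?_ ?_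
    · exact matrix_add_le F2.1 (by simpa only [Matrix.mul_assoc] using F2.2)
    · refine matrix_add_le ?_ ?_
      · simpa only [Matrix.mul_assoc] using le_mul_one' (Fs * B)
      · simpa only [Matrix.mul_assoc] using matrix_mul_mono (le_refl (Fs * B)) hD.le_mul
    · refine matrix_add_le ?_ ?_
      · simpa only [Matrix.mul_assoc] using matrix_mul_mono (le_refl (Ds * C)) F2.1
      · rw [Matrix.add_mul]
        refine matrix_add_le ?_ ?_
        · simpa only [Matrix.mul_assoc] using matrix_mul_mono (le_refl (Ds * C)) F2.2
        · simpa only [Matrix.mul_assoc] using le_mul_one (Ds * C)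
    · refine matrix_add_le ?_ ?_
      · refine le_trans ?_ (hadd _ _).1
        simpa only [Matrix.mul_assoc] using le_mul_one' (Ds * C * Fs * B)
      · rw [Matrix.add_mul]
        refine matrix_add_le ?_ (hD.le_mul.trans (hadd _ _).2)
        refine le_trans ?_ (hadd _ _).1
        simpa only [Matrix.mul_assoc] using matrix_mul_mono (le_refl (Ds * C * Fs * B)) hD.le_mul
  · intro k Y hY
    obtain ⟨Y₁, Y₂, rfl⟩ : ∃ (Y₁ : Matrix m k K) (Y₂ : Matrix n k K), Y = Matrix.fromRows Y₁ Y₂ :=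
      ⟨_, _, (Matrix.fromRows_toRows Y).symm⟩
    rw [Matrix.fromBlocks_mul_fromRows] at hY ⊢
    have h₁ : A * Y₁ + B * Y₂ ≤ Y₁ := fun i j => hY (Sum.inl i) j
    have h₂ : C * Y₁ + D * Y₂ ≤ Y₂ := fun i j => hY (Sum.inr i) j
    rw [matrix_add_le_iff] at h₁ h₂
    have hds := hD.left k Y₂ h₂.2
    have hdc : Ds * (C * Y₁) ≤ Y₂ := (matrix_mul_mono le_rfl h₂.1).trans hds
    have hfs : Fs * Y₁ ≤ Y₁ := by
      refine hF.left k Y₁ ?_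
      rw [Matrix.add_mul]
      refine matrix_add_le h₁.1 ?_
      simpa only [Matrix.mul_assoc] using (matrix_mul_mono (le_refl B) hdc).trans h₁.2
    have hfb : Fs * B * Ds * Y₂ ≤ Y₁ := by
      have := (matrix_mul_mono (le_refl Fs) ((matrix_mul_mono (le_refl B) hds).trans h₁.2)).trans hfs
      simpa only [Matrix.mul_assoc] using this
    have t₁ : Fs * Y₁ + Fs * B * Ds * Y₂ ≤ Y₁ := matrix_add_le hfs hfb
    have t₂ : Ds * C * Fs * Y₁ + (Ds * C * Fs * B * Ds + Ds) * Y₂ ≤ Y₂ := by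
      refine matrix_add_le ?_ ?_
      · have := (matrix_mul_mono (le_refl Ds) (matrix_mul_mono (le_refl C) hfs)).trans hdc
        simpa only [Matrix.mul_assoc] using this
      · rw [Matrix.add_mul]
        refine matrix_add_le ?_ hds
        have := (matrix_mul_mono (le_refl Ds) (matrix_mul_mono (le_refl C) hfb)).trans hdc
        simpa only [Matrix.mul_assoc] using this
    rintro (i | i) j
    exacts [t₁ i j, t₂ i j]
  · intro k Y hY
    obtain ⟨Y₁, Y₂, rfl⟩ : ∃ (Y₁ : Matrix k m K) (Y₂ : Matrix k n K), Y = Matrix.fromCols Y₁ Y₂ :=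
      ⟨_, _, (Matrix.fromCols_toCols Y).symm⟩
    rw [Matrix.fromCols_mul_fromBlocks] at hY ⊢
    have h₁ : Y₁ * A + Y₂ * C ≤ Y₁ := fun i j => hY i (Sum.inl j)
    have h₂ : Y₁ * B + Y₂ * D ≤ Y₂ := fun i j => hY i (Sum.inr j)
    rw [matrix_add_le_iff] at h₁ h₂
    have hds := hD.right k Y₂ h₂.2
    have hbd : Y₁ * B * Ds ≤ Y₂ := (matrix_mul_mono h₂.1 le_rfl).trans hds
    have hfs : Y₁ * Fs ≤ Y₁ := by
      refine hF.right k Y₁ ?_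
      rw [Matrix.mul_add]
      refine matrix_add_le h₁.1 ?_
      simpa only [Matrix.mul_assoc] using (matrix_mul_mono hbd (le_refl C)).trans h₁.2
    have hdc : Y₂ * Ds * C * Fs ≤ Y₁ :=
      (matrix_mul_mono ((matrix_mul_mono hds (le_refl C)).trans h₁.2) (le_refl Fs)).trans hfs
    have t₁ : Y₁ * Fs + Y₂ * (Ds * C * Fs) ≤ Y₁ :=
      matrix_add_le hfs (by simpa only [Matrix.mul_assoc] using hdc)
    have t₂ : Y₁ * (Fs * B * Ds) + Y₂ * (Ds * C * Fs * B * Ds + Ds) ≤ Y₂ := by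
      refine matrix_add_le ?_ ?_
      · have := (matrix_mul_mono (matrix_mul_mono hfs (le_refl B)) (le_refl Ds)).trans hbd
        simpa only [Matrix.mul_assoc] using this
      · rw [Matrix.mul_add]
        refine matrix_add_le ?_ hds
        have := (matrix_mul_mono (matrix_mul_mono hdc (le_refl B)) (le_refl Ds)).trans hbd
        simpa only [Matrix.mul_assoc] using this
    rintro i (j | j)
    exacts [t₁ i j, t₂ i j]

theorem isMatrixStar_submatrix [IdemSemiring K] {m n : Type} [Fintype m] [DecidableEq m]
    [Fintype n] [DecidableEq n] (e : m ≃ n) (M : Matrix n n K)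
    (S : Matrix m m K) (h : IsMatrixStar (M.submatrix e e) S) : IsMatrixStar M (S.submatrix e.symm e.symm) := by
  have hM : M = (M.submatrix e e).submatrix e.symm e.symm := by simp
  generalize M.submatrix e e = M' at h hM
  subst hM
  refine ⟨?_, ?_, ?_, ?_, ?_⟩
  · rw [← Matrix.submatrix_one_equiv e.symm]
    exact fun i j => h.one_le _ _
  · rw [Matrix.submatrix_mul_equiv]
    exact fun i j => h.mul_le _ _
  · rw [Matrix.submatrix_mul_equiv]
    exact fun i j => h.le_mul _ _
  · intro k Y hY
    obtain ⟨Y, rfl⟩ : ∃ Y' : Matrix m k K, Y = Y'.submatrix e.symm id :=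
      ⟨Y.submatrix e id, by ext; simp⟩
    rw [Matrix.submatrix_mul_equiv] at hY ⊢
    have := h.left k Y fun i j => by simpa using hY (e i) j
    exact fun i j => this _ _
  · intro k Y hY
    obtain ⟨Y, rfl⟩ : ∃ Y' : Matrix k m K, Y = Y'.submatrix id e.symm :=
      ⟨Y.submatrix id e, by ext; simp⟩
    rw [Matrix.submatrix_mul_equiv] at hY ⊢
    have := h.right k Y fun i j => by simpa using hY i (e j)
    exact fun i j => this _ _

theorem isMatrixStar_one_by_one [RDioid K] (D : Matrix (Fin 1) (Fin 1) K) :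
    IsMatrixStar D (D.map KStar.kstar) := by
  refine ⟨?_, ?_, ?_, ?_, ?_⟩
  · intro i j
    rw [Subsingleton.elim i j, Matrix.one_apply_eq]
    exact one_le_kstar
  · intro i j
    simpa [Matrix.mul_apply, Subsingleton.elim i 0, Subsingleton.elim j 0] using
      mul_kstar_le_kstar (a := D 0 0)
  · intro i j
    simpa [Matrix.mul_apply, Subsingleton.elim i 0, Subsingleton.elim j 0] using
      kstar_mul_le_kstar (a := D 0 0)
  · intro k Y hY i j
    have := hY 0 j
    simp only [Matrix.mul_apply, Fin.sum_univ_one, Matrix.map_apply,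
      Subsingleton.elim i 0] at this ⊢
    exact kstar_mul_le_self this
  · intro k Y hY i j
    have := hY i 0
    simp only [Matrix.mul_apply, Fin.sum_univ_one, Matrix.map_apply,
      Subsingleton.elim j 0] at this ⊢
    exact mul_kstar_le_self this

theorem isMatrixStar_matrixStar [RDioid K] (n : ℕ) (M : Matrix (Fin n) (Fin n) K) :
    IsMatrixStar M (matrixStar n M) := by
  induction n with
  | zero =>
    exact ⟨fun i => i.elim0, fun i => i.elim0, fun i => i.elim0, fun _ _ _ i => i.elim0,
      fun _ _ _ _ j => j.elim0⟩
  | succ n ih =>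
    refine isMatrixStar_submatrix finSumFinEquiv _ _ ?_
    let M' : Matrix (Fin n ⊕ Fin 1) (Fin n ⊕ Fin 1) K := M.submatrix finSumFinEquiv finSumFinEquiv
    have := isMatrixStar_fromBlocks M'.toBlocks₁₁ M'.toBlocks₁₂ M'.toBlocks₂₁ M'.toBlocks₂₂ _ _
      (isMatrixStar_one_by_one M'.toBlocks₂₂) (ih _)
    rwa [Matrix.fromBlocks_toBlocks] at this

/-- The Kleene algebra `Mat n n K` of square matrices over an `ℛ`-dioid. -/
noncomputable instance matrixKleeneAlgebra [RDioid K] (n : ℕ) :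
    KleeneAlgebra (Matrix (Fin n) (Fin n) K) where
  kstar := matrixStar n
  one_le_kstar M := (isMatrixStar_matrixStar n M).one_le
  mul_kstar_le_kstar M := (isMatrixStar_matrixStar n M).mul_le
  kstar_mul_le_kstar M := (isMatrixStar_matrixStar n M).le_mul
  mul_kstar_le_self M Y h := (isMatrixStar_matrixStar n M).right _ Y h
  kstar_mul_le_self M Y h := (isMatrixStar_matrixStar n M).left _ Y h

end MatrixKleene

/-- The centralizer `Z_{C}(K ⊗_ℛ C)` of (the image of) `C` in `K ⊗_ℛ C`. -/
def tensorCentralizer (K C : Type*) [RDioid K] [RDioid C] : Set (RTensor K C) :=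
  {z | ∀ c : C, z * RTensor.inr c = RTensor.inr c * z}

/-! ## Homomorphisms preserving regular suprema -/

/-! Every element of the tensor product arises from `K` and the four brackets by sum, product and
iteration (`RTensor.induction_polycyclic`), so Kleene's automaton constructions give `φ = S A* F`
with `A = U + V + X` (`IsRecognizable`). It remains to factor `A*`. After cancelling matched
brackets, a run consists of balanced pieces separated first by closing and then by opening brackets;
hence `A* = (NV)* N (UN)*` (`kstar_add_eq_of_bracket`), provided that `N i j` is the sum of the
values in `K` of the balanced runs from `i` to `j`.

These values form a context-free set, in general not a regular one, so their sum need not exist in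
`K`. It exists in the tensor product by a recoding: the pairs `bp, qd` and `pp, qq` multiply among
themselves like `b, d` and `p, q`, while `b` and `d` are set free as end markers, since `bd = 1` and
`b·qd = b·qq = bp·d = pp·d = 0`. If `A'` is the automaton with recoded brackets, put `N = b A'* d`.
A balanced run of value `k` contributes `b k d = k`; an unmatched closing bracket is killed by `b`
on the left, an unmatched opening one by `d` on the right.

The precise form is `MarkedBrackets.mul_balancedMatrix_mul_le`: `x N y ≤ z` holds as soon as `x k y
≤ z` for all balanced values `k`. It reduces every claim about `N` to single values `k` in `K`: `N`
commutes with `C₂'` because `K` does (`MarkedBrackets.commute_balancedMatrix`), and `N` is the least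
solution because balanced runs are generated by the clauses that the inequation encodes
(`MarkedBrackets.isLeast_balancedMatrix`). -/

theorem IsRegularSet.image {M N : Type*} [Monoid M] [Monoid N] (g : M →* N) {A : Set M}
    (hA : IsRegularSet A) : IsRegularSet (g '' A) := by
  induction hA with
  | empty => rw [Set.image_empty]; exact .empty
  | singleton m => rw [Set.image_singleton]; exact .singleton _
  | union A B _ _ h₁ h₂ => rw [Set.image_union]; exact .union _ _ h₁ h₂
  | mul A B _ _ h₁ h₂ => rw [Set.image_mul]; exact .mul _ _ h₁ h₂
  | star A _ h =>
    have : g '' (⋃ n : ℕ, A ^ n) = ⋃ n : ℕ, (g '' A) ^ n := by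
      rw [Set.image_iUnion]
      exact Set.iUnion_congr fun n => Set.image_pow _ _ _
    rw [this]; exact .star _ h

/-- A monoid homomorphism of `ℛ`-dioids preserving the suprema of regular sets. -/
def IsRContinuous {D E : Type*} [RDioid D] [RDioid E] (g : D →* E) : Prop :=
  ∀ (A : Set D) (s : D), IsRegularSet A → IsLUB A s → IsLUB (g '' A) (g s)

namespace IsRContinuous

variable {D E : Type*} [RDioid D] [RDioid E] {g : D →* E} (hg : IsRContinuous g)
include hg

/-- Zero is the supremum of the empty set, which is regular. -/
theorem map_zero : g 0 = 0 := by
  have h := hg ∅ 0 .empty (by simp [isLUB_empty_iff, IsBot])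
  rw [Set.image_empty, isLUB_empty_iff] at h
  exact le_antisymm (h 0) zero_le

theorem map_add (a b : D) : g (a + b) = g a + g b := by
  have h := hg ({a} ∪ {b}) (a + b) (.union _ _ (.singleton a) (.singleton b))
    (by rw [add_eq_sup]; exact isLUB_singleton.union isLUB_singleton)
  rw [Set.image_union, Set.image_singleton, Set.image_singleton] at h
  refine h.unique ?_
  rw [add_eq_sup]
  exact isLUB_singleton.union isLUB_singleton

theorem map_kstar (a : D) : g (KStar.kstar a) = KStar.kstar (g a) := by
  have h := hg _ _ (.star _ (.singleton a)) (RDioid.isLUB_star a)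
  rw [Set.image_iUnion] at h
  simp only [Set.image_pow, Set.image_singleton] at h
  exact h.unique (RDioid.isLUB_star (g a))

/-- An `ℛ`-continuous homomorphism as a semiring homomorphism. -/
def toRingHom : D →+* E where
  __ := g
  map_zero' := hg.map_zero
  map_add' := hg.map_add

end IsRContinuous

theorem RQuotient.isRContinuous_mk {D : Type*} [RDioid D] (r : D → D → Prop) :
    IsRContinuous (RQuotient.mk r : D →* RQuotient r) :=
  fun V s hV hs => RQuotient.isLUB_image r V hV s hs

theorem RQuotient.mk_eq_of_rel {D : Type*} [RDioid D] {r : D → D → Prop} {x y : D} (h : r x y) :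
    RQuotient.mk r x = RQuotient.mk r y :=
  (RingCon.eq _).2 (rCongruenceGen_of r x y h)

/-- `m ↦ {m}` as a monoid homomorphism. -/
def RegSet.singleHom (M : Type*) [Monoid M] : M →* RegSet M where
  toFun := RegSet.single
  map_one' := rfl
  map_mul' _ _ := Subtype.ext (Set.singleton_mul_singleton).symm

/-- Together with continuity, this determines a map out of `ℛM` by its values on singletons. -/
theorem RegSet.isLUB_image_single {M : Type*} [Monoid M] (A : RegSet M) :
    IsLUB (RegSet.single '' A.1) A := by
  constructor
  · rintro _ ⟨m, hm, rfl⟩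
    exact Set.singleton_subset_iff.2 hm
  · intro B hB m hm
    exact hB ⟨m, hm, rfl⟩ rfl

theorem RegSet.isLUB_map_image_single {M E : Type*} [Monoid M] [RDioid E] {g : RegSet M →* E}
    (hg : IsRContinuous g) (A : RegSet M) :
    IsLUB ((fun m => g (RegSet.single m)) '' A.1) (g A) := by
  have := hg _ _ (A.2.image (RegSet.singleHom M)) A.isLUB_image_single
  rwa [Set.image_image] at this

/-- Matches the iteration clause of `IsRegularSet` with the Kleene star of the dioid `ℛM`, as the
induction over regular sets requires. -/
theorem RegSet.kstar_eq {M : Type*} [Monoid M] (A : RegSet M) :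
    KStar.kstar A = ⟨⋃ n : ℕ, A.1 ^ n, .star _ A.2⟩ := by
  have hpow (n : ℕ) : (A ^ n).1 = A.1 ^ n := by
    induction n with
    | zero => rfl
    | succ n ih => rw [pow_succ, pow_succ, ← ih]; rfl
  refine (RDioid.isLUB_star A).unique ⟨?_, ?_⟩
  · intro B hB
    obtain ⟨n, rfl⟩ := (RDioid.mem_powers A B).1 hB
    refine Set.Subset.trans (hpow n).subset (Set.subset_iUnion (fun n => A.1 ^ n) n)
  · intro B hB
    refine Set.iUnion_subset fun n => (hpow n).symm.subset.trans ?_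
    exact hB ((RDioid.mem_powers A _).2 ⟨n, rfl⟩)

/-- A property of elements of `E` that contains the images of singletons and is closed under the
Kleene algebra operations holds on the image of `ℛM`. -/
theorem RegSet.induction_image {M E : Type*} [Monoid M] [RDioid E] {g : RegSet M →* E}
    (hg : IsRContinuous g) {p : E → Prop} (zero : p 0)
    (single : ∀ m, p (g (RegSet.single m))) (add : ∀ x y, p x → p y → p (x + y))
    (mul : ∀ x y, p x → p y → p (x * y)) (star : ∀ x, p x → p (KStar.kstar x))
    (A : RegSet M) : p (g A) := by
  obtain ⟨A, hA⟩ := A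
  induction hA with
  | empty => exact hg.map_zero ▸ zero
  | singleton m => exact single m
  | union A B hA hB h₁ h₂ => exact hg.map_add ⟨A, hA⟩ ⟨B, hB⟩ ▸ add _ _ h₁ h₂
  | mul A B hA hB h₁ h₂ => exact map_mul g ⟨A, hA⟩ ⟨B, hB⟩ ▸ mul _ _ h₁ h₂
  | star A hA h =>
    have e := (congrArg g (RegSet.kstar_eq ⟨A, hA⟩)).symm.trans (hg.map_kstar _)
    exact (congrArg p e).mpr (star _ h)

/-! ### The canonical maps into the tensor product -/

namespace RTensor

variable (K C : Type*) [RDioid K] [RDioid C]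

/-- The canonical map `(a, c) ↦ [{(a, c)}]` into the tensor product. -/
def pure : K × C →* RTensor K C :=
  (RQuotient.mk (TensorRel K C) : _ →* RTensor K C).comp (RegSet.singleHom (K × C))

/-- `RTensor.inl` as a monoid homomorphism. -/
def inlMonoidHom : K →* RTensor K C := (pure K C).comp (MonoidHom.inl K C)

/-- `RTensor.inr` as a monoid homomorphism. -/
def inrMonoidHom : C →* RTensor K C := (pure K C).comp (MonoidHom.inr K C)

variable {K C}

theorem isRegularSet_prod_one {A : Set K} (hA : IsRegularSet A) :
    IsRegularSet (A ×ˢ ({1} : Set C)) := by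
  rw [Set.prod_singleton]; exact hA.image (MonoidHom.inl K C)

theorem isRegularSet_one_prod {B : Set C} (hB : IsRegularSet B) :
    IsRegularSet (({1} : Set K) ×ˢ B) := by
  rw [Set.singleton_prod]; exact hB.image (MonoidHom.inr K C)

/-- The class of `A × {1}` is the supremum of the classes of its elements, and the tensor equation
for `A` and `{1}` identifies it with the class of `(s, 1)`. -/
theorem isRContinuous_inl : IsRContinuous (inlMonoidHom K C) := by
  intro A s hA hs
  have h : IsLUB (pure K C '' (A ×ˢ {1})) (RQuotient.mk (TensorRel K C) _) :=
    RegSet.isLUB_map_image_single (RQuotient.isRContinuous_mk (TensorRel K C))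
      ⟨A ×ˢ {1}, isRegularSet_prod_one hA⟩
  have e : RQuotient.mk (TensorRel K C) ⟨A ×ˢ {1}, isRegularSet_prod_one hA⟩ =
      RQuotient.mk (TensorRel K C) (RegSet.single (s, 1)) :=
    RQuotient.mk_eq_of_rel ⟨A, {1}, s, 1, hA, .singleton 1, hs, isLUB_singleton, rfl, rfl⟩
  rw [e, Set.prod_singleton, Set.image_image] at h
  exact h

theorem isRContinuous_inr : IsRContinuous (inrMonoidHom K C) := by
  intro B t hB ht
  have h : IsLUB (pure K C '' ({1} ×ˢ B)) (RQuotient.mk (TensorRel K C) _) :=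
    RegSet.isLUB_map_image_single (RQuotient.isRContinuous_mk (TensorRel K C))
      ⟨{1} ×ˢ B, isRegularSet_one_prod hB⟩
  have e : RQuotient.mk (TensorRel K C) ⟨{1} ×ˢ B, isRegularSet_one_prod hB⟩ =
      RQuotient.mk (TensorRel K C) (RegSet.single (1, t)) :=
    RQuotient.mk_eq_of_rel ⟨{1}, B, 1, t, .singleton 1, hB, isLUB_singleton, ht, rfl, rfl⟩
  rw [e, Set.singleton_prod, Set.image_image] at h
  exact h

variable (K C) in
/-- `RTensor.inl` as a semiring homomorphism. -/
def inlHom : K →+* RTensor K C := isRContinuous_inl.toRingHom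

variable (K C) in
/-- `RTensor.inr` as a semiring homomorphism. -/
def inrHom : C →+* RTensor K C := isRContinuous_inr.toRingHom

theorem inl_mul_inr (a : K) (c : C) :
    inlHom K C a * inrHom K C c = pure K C (a, c) := by
  refine (map_mul (pure K C) (a, 1) (1, c)).symm.trans ?_
  simp

theorem inr_mul_inl (a : K) (c : C) :
    inrHom K C c * inlHom K C a = pure K C (a, c) := by
  refine (map_mul (pure K C) (1, c) (a, 1)).symm.trans ?_
  simp

theorem commute_inl_inr (a : K) (c : C) : Commute (inlHom K C a) (inrHom K C c) :=
  (inl_mul_inr a c).trans (inr_mul_inl a c).symm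

end RTensor

theorem Polycyclic.opening_mul_closing {m : ℕ} (i j : Fin m) :
    (opening i * closing j : Polycyclic m) = if i = j then 1 else 0 := by
  have h := RQuotient.mk_eq_of_rel (BracketRel.mk i j)
  rw [apply_ite (RQuotient.mk _), map_one, map_zero] at h
  rw [← h, opening, closing, ← map_mul]
  exact congrArg _ (map_mul (RegSet.singleHom _) _ _).symm

/-- A property of elements of `K ⊗_ℛ Cₘ'` that contains `K` and the brackets and is closed under the
Kleene algebra operations holds everywhere. -/
theorem RTensor.induction_polycyclic {K : Type*} [RDioid K] {m : ℕ}
    {p : RTensor K (Polycyclic m) → Prop} (inl : ∀ k, p (inlHom _ _ k))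
    (opening : ∀ i, p (inrHom _ _ (Polycyclic.opening i)))
    (closing : ∀ i, p (inrHom _ _ (Polycyclic.closing i)))
    (add : ∀ x y, p x → p y → p (x + y)) (mul : ∀ x y, p x → p y → p (x * y))
    (star : ∀ x, p x → p (KStar.kstar x)) (φ : RTensor K (Polycyclic m)) : p φ := by
  have zero : p 0 := map_zero (inlHom K (Polycyclic m)) ▸ inl 0
  have one : p 1 := map_one (inlHom K (Polycyclic m)) ▸ inl 1
  -- An element of `Cₘ'` is the class of a regular set of words; words are in turn products of
  -- single brackets.
  have inr (c : Polycyclic m) : p (inrHom _ _ c) := by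
    obtain ⟨B, rfl⟩ := RQuotient.mk_surjective _ c
    refine RegSet.induction_image (RQuotient.isRContinuous_mk (BracketRel m))
      (p := fun c => p (inrHom _ _ c)) ?_ (fun w => ?_) (fun x y hx hy => ?_)
      (fun x y hx hy => ?_) (fun x hx => ?_) B
    · rwa [map_zero]
    · induction w using FreeMonoid.inductionOn' with
      | one =>
        have : RegSet.single (1 : FreeMonoid (PolyBracket m)) = 1 := rfl
        rwa [this, map_one, map_one]
      | of_mul a w ih =>
        have : RegSet.single (FreeMonoid.of a * w) = RegSet.single (.of a) * RegSet.single w :=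
          map_mul (RegSet.singleHom _) _ _
        rw [this, map_mul, map_mul]
        refine mul _ _ ?_ ih
        cases a with
        | opening i => exact opening i
        | closing i => exact closing i
    · rw [map_add]; exact add _ _ hx hy
    · rw [map_mul]; exact mul _ _ hx hy
    · have := isRContinuous_inr (K := K).map_kstar x
      exact this ▸ star _ hx
  obtain ⟨A, rfl⟩ := RQuotient.mk_surjective _ φ
  refine RegSet.induction_image (RQuotient.isRContinuous_mk (TensorRel K (Polycyclic m)))
    zero (fun ⟨k, c⟩ => ?_) add mul star A
  -- The class of a pair `(k, c)` is the product of `k` and `c`.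
  exact inl_mul_inr k c ▸ mul _ _ (inl k) (inr c)

/-! ## Iteration of matrices -/

/-- `S ≤ S T ≤ T` by reflexivity of `T` and the induction axiom for `S`. An iteration found by any
block splitting or indexing of the states therefore agrees with `matrixStar`. -/
theorem IsMatrixStar.unique {L : Type*} [IdemSemiring L] {n : Type} [Fintype n] [DecidableEq n]
    {M S T : Matrix n n L} (hS : IsMatrixStar M S) (hT : IsMatrixStar M T) : S = T := by
  have key {S T : Matrix n n L} (hS : IsMatrixStar M S) (hT : IsMatrixStar M T) : S ≤ T := by
    have h := matrix_mul_mono (le_refl S) hT.one_le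
    rw [Matrix.mul_one] at h
    exact h.trans (hS.left n T hT.mul_le)
  exact le_antisymm (key hS hT) (key hT hS)

theorem isMatrixStar_one_add {L : Type*} [IdemSemiring L] {n : Type} [Fintype n] [DecidableEq n]
    {M : Matrix n n L} (hM : M * M = 0) : IsMatrixStar M (1 + M) := by
  have h1 : (1 : Matrix n n L) ≤ 1 + M := (matrix_add_le_iff.1 le_rfl).1
  have h2 : M ≤ 1 + M := (matrix_add_le_iff.1 le_rfl).2
  refine ⟨h1, ?_, ?_, fun k Y hY => ?_, fun k Y hY => ?_⟩
  · rwa [Matrix.mul_add, hM, Matrix.mul_one, add_zero]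
  · rwa [Matrix.add_mul, hM, Matrix.one_mul, add_zero]
  · rw [Matrix.add_mul, Matrix.one_mul]
    exact matrix_add_le le_rfl hY
  · rw [Matrix.mul_add, Matrix.mul_one]
    exact matrix_add_le le_rfl hY

theorem RDioid.mul_kstar_mul_le {L : Type*} [RDioid L] {a b c z : L}
    (h : ∀ n : ℕ, a * c ^ n * b ≤ z) : a * KStar.kstar c * b ≤ z :=
  (RDioid.isLUB_mul_star_mul a b c).2 (by rintro _ ⟨n, rfl⟩; exact h n)

/-! ### Entrywise invariants of matrix iteration -/

/-- Families of sets of elements of `L` that contain the entries of the unit matrix and are closed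
under the operations by which the entries of `M*` are computed from those of `M`. -/
structure IsPathClosed {L I : Type*} [RDioid L] (D : I → I → Set L) : Prop where
  zero_mem : ∀ i j, 0 ∈ D i j
  one_mem : ∀ i, 1 ∈ D i i
  add_mem : ∀ {i j a b}, a ∈ D i j → b ∈ D i j → a + b ∈ D i j
  mul_mem : ∀ {i j k a b}, a ∈ D i j → b ∈ D j k → a * b ∈ D i k
  kstar_mem : ∀ {i a}, a ∈ D i i → KStar.kstar a ∈ D i i

section IsPathClosed

variable {L I : Type*} [RDioid L] {D : I → I → Set L} (hD : IsPathClosed D)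
include hD

theorem IsPathClosed.sum_mem {α : Type*} (s : Finset α) {i j : I} {g : α → L}
    (h : ∀ a ∈ s, g a ∈ D i j) : ∑ a ∈ s, g a ∈ D i j := by
  classical
  induction s using Finset.induction_on with
  | empty => exact hD.zero_mem i j
  | insert a s ha ih =>
    rw [Finset.sum_insert ha]
    exact hD.add_mem (h _ (Finset.mem_insert_self _ _))
      (ih fun b hb => h b (Finset.mem_insert_of_mem hb))

theorem IsPathClosed.matrix_mul_mem {l m n : Type*} [Fintype m] {r : l → I} {s : m → I}
    {t : n → I} {X : Matrix l m L} {Y : Matrix m n L} (hX : ∀ i j, X i j ∈ D (r i) (s j))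
    (hY : ∀ i j, Y i j ∈ D (s i) (t j)) (i : l) (j : n) : (X * Y) i j ∈ D (r i) (t j) := by
  rw [Matrix.mul_apply]
  exact hD.sum_mem _ fun k _ => hD.mul_mem (hX i k) (hY k j)

/-- The recursion for `M*` only adds entries with the same end points, multiplies composable ones
and iterates loops, so an invariant typed by end points passes from `M` to `M*`. -/
theorem IsPathClosed.matrixStar_mem {n : ℕ} (r : Fin n → I) (M : Matrix (Fin n) (Fin n) L)
    (hM : ∀ i j, M i j ∈ D (r i) (r j)) (i j : Fin n) : matrixStar n M i j ∈ D (r i) (r j) := by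
  induction n with
  | zero => exact i.elim0
  | succ n ih =>
    let M' : Matrix (Fin n ⊕ Fin 1) (Fin n ⊕ Fin 1) L := M.submatrix finSumFinEquiv finSumFinEquiv
    let r₁ : Fin n → I := fun i => r (finSumFinEquiv (Sum.inl i))
    let r₂ : Fin 1 → I := fun i => r (finSumFinEquiv (Sum.inr i))
    have hA : ∀ i j, M'.toBlocks₁₁ i j ∈ D (r₁ i) (r₁ j) := fun i j => hM _ _
    have hB : ∀ i j, M'.toBlocks₁₂ i j ∈ D (r₁ i) (r₂ j) := fun i j => hM _ _
    have hC : ∀ i j, M'.toBlocks₂₁ i j ∈ D (r₂ i) (r₁ j) := fun i j => hM _ _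
    have hDs : ∀ i j, M'.toBlocks₂₂.map KStar.kstar i j ∈ D (r₂ i) (r₂ j) := fun i j => by
      -- The corner block has a single state, so its entry is a loop.
      rw [Subsingleton.elim j i]
      exact hD.kstar_mem (hM _ _)
    have hFs := ih r₁ _ fun i j =>
      hD.add_mem (hA i j) (hD.matrix_mul_mem (hD.matrix_mul_mem hB hDs) hC i j)
    have key : ∀ i j, matrixStar (n + 1) M (finSumFinEquiv i) (finSumFinEquiv j) ∈
        D (r (finSumFinEquiv i)) (r (finSumFinEquiv j)) := by
      intro i j
      simp only [matrixStar, Matrix.submatrix_apply, Equiv.symm_apply_apply]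
      have hCF := hD.matrix_mul_mem (hD.matrix_mul_mem hDs hC) hFs
      rcases i with i | i <;> rcases j with j | j
      · exact hFs i j
      · exact hD.matrix_mul_mem (hD.matrix_mul_mem hFs hB) hDs i j
      · exact hCF i j
      · exact hD.add_mem (hD.matrix_mul_mem (hD.matrix_mul_mem hCF hB) hDs i j) (hDs i j)
    have := key (finSumFinEquiv.symm i) (finSumFinEquiv.symm j)
    simpa only [Equiv.apply_symm_apply] using this

end IsPathClosed

/-- `a` maps all upper bounds of `W j` to upper bounds of `W i`. -/
def mulLeSet {L I : Type*} [RDioid L] (W : I → Set L) (i j : I) : Set L :=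
  {a | ∀ y z, (∀ w ∈ W j, w * y ≤ z) → ∀ w ∈ W i, w * a * y ≤ z}

/-- Iteration is the only clause that needs more than the semiring laws: all powers of `a` preserve
the bounds by induction, and `*`-continuity passes to their supremum inside a product. -/
theorem isPathClosed_mulLeSet {L I : Type*} [RDioid L] (W : I → Set L) :
    IsPathClosed (mulLeSet W) where
  zero_mem i j y z _ w _ := by simp
  one_mem i y z h w hw := by simpa using h w hw
  add_mem ha hb y z h w hw := by
    rw [mul_add, add_mul]
    exact add_le (ha y z h w hw) (hb y z h w hw)
  mul_mem {i j k a b} ha hb y z h w hw := by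
    rw [← mul_assoc, mul_assoc _ b y]
    refine ha _ _ (fun v hv => ?_) w hw
    rw [← mul_assoc]
    exact hb y z h v hv
  kstar_mem {i a} ha y z h w hw := by
    refine RDioid.mul_kstar_mul_le fun n => ?_
    induction n generalizing w with
    | zero => simpa using h w hw
    | succ n ih =>
      rw [pow_succ', ← mul_assoc, mul_assoc _ (a ^ n) y]
      refine ha _ _ (fun v hv => ?_) w hw
      rw [← mul_assoc]
      exact ih v hv

/-- If the rows `W` satisfy `W M ≤ W`, then `W M* ≤ W`; here the entries of `W` need not be
elements of `L`. -/
theorem matrixStar_mem_mulLeSet {L : Type*} [RDioid L] {n : ℕ} {W : Fin n → Set L}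
    {M : Matrix (Fin n) (Fin n) L} (hM : ∀ i j, M i j ∈ mulLeSet W i j) (i j : Fin n) :
    KStar.kstar M i j ∈ mulLeSet W i j :=
  (isPathClosed_mulLeSet W).matrixStar_mem id M hM i j

/-- In a Kleene algebra, `(u + v + x)* = (n v)* n (u n)*` if `n` is reflexive and transitive with
`x ≤ n`, `u n v ≤ n` and `n ≤ (u + v + x)*`. -/
theorem kstar_add_eq_of_bracket {A : Type*} [KleeneAlgebra A] {u v x n : A} (h1 : 1 ≤ n)
    (hnn : n * n ≤ n) (hx : x ≤ n) (hunv : u * n * v ≤ n) (hn : n ≤ KStar.kstar (u + v + x)) :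
    KStar.kstar (u + v + x) = KStar.kstar (n * v) * n * KStar.kstar (u * n) := by
  have hn1 (y : A) : y ≤ y * n := by simpa using mul_le_mul' (le_refl y) h1
  have hle : u + v + x ≤ KStar.kstar (u + v + x) := le_kstar
  rw [add_le_iff, add_le_iff] at hle
  have hss := (kstar_mul_kstar (u + v + x)).le
  generalize hP : KStar.kstar (n * v) = P
  generalize hQ : KStar.kstar (u * n) = Q
  have hP1 : 1 ≤ P := hP ▸ one_le_kstar
  have hQ1 : 1 ≤ Q := hQ ▸ one_le_kstar
  apply le_antisymm
  · have hPR : P ≤ P * n * Q :=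
      (hn1 P).trans (by simpa using mul_le_mul' (le_refl (P * n)) hQ1)
    have hQun : Q = 1 + Q * (u * n) := by rw [← hQ, one_add_kstar_mul]
    have hQu : Q * (u * n) ≤ Q := hQ ▸ kstar_mul_le_kstar
    have hPn : P * (n * v) ≤ P := hP ▸ kstar_mul_le_kstar
    -- A trailing `n` is absorbed by transitivity, either into the last factor `u n` of `Q` or, if
    -- there is none, into the leading `n`.
    have hQn : n * Q * n ≤ n * Q := by
      have h : Q * n ≤ n + Q := by
        calc Q * n = n + Q * u * (n * n) := by
              conv_lhs => rw [hQun]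
              simp only [add_mul, one_mul, mul_assoc]
          _ ≤ n + Q * u * n := add_le_add le_rfl (mul_le_mul' le_rfl hnn)
          _ ≤ n + Q := add_le_add le_rfl (by rwa [mul_assoc])
      rw [mul_assoc]
      refine (mul_le_mul' le_rfl h).trans ?_
      rw [mul_add]
      exact add_le (hnn.trans (by simpa using mul_le_mul' (le_refl n) hQ1)) le_rfl
    -- A closing bracket either finds no open one and yields a factor `n v`, or cancels the last
    -- open one through `u n v ≤ n`.
    have hQv : n * Q * v ≤ n * v + n * Q := by
      calc n * Q * v = n * v + n * Q * (u * n * v) := by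
            conv_lhs => rw [hQun]
            simp only [mul_add, add_mul, mul_one, mul_assoc]
        _ ≤ n * v + n * Q * n := add_le_add le_rfl (mul_le_mul' le_rfl hunv)
        _ ≤ n * v + n * Q := add_le_add le_rfl hQn
    -- By induction it suffices that right multiplication by `u`, `v` and `x` stays below `P n Q`.
    refine kstar_le_of_mul_le_left (hP1.trans hPR) ?_
    simp only [mul_add]
    refine add_le (add_le ?_ ?_) ?_
    · refine (hn1 _).trans ?_
      simpa only [mul_assoc] using mul_le_mul' (le_refl (P * n)) hQu
    · have h := mul_le_mul' (le_refl P) hQv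
      rw [mul_add, ← mul_assoc, ← mul_assoc] at h
      exact h.trans (add_le (hPn.trans hPR) le_rfl)
    · refine (mul_le_mul' le_rfl hx).trans ?_
      simpa only [mul_assoc] using mul_le_mul' (le_refl P) hQn
  · have hP' : P ≤ KStar.kstar (u + v + x) := hP ▸
      kstar_le_of_mul_le_left one_le_kstar
        ((mul_le_mul' le_rfl ((mul_le_mul' hn hle.1.2).trans hss)).trans hss)
    have hQ' : Q ≤ KStar.kstar (u + v + x) := hQ ▸
      kstar_le_of_mul_le_left one_le_kstar
        ((mul_le_mul' le_rfl ((mul_le_mul' hle.1.1 hn).trans hss)).trans hss)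
    exact (mul_le_mul' ((mul_le_mul' hP' hn).trans hss) hQ').trans hss

/-! ## Automata over `K` and two pairs of brackets -/

/-- The transition matrix with opening brackets at the places given by `u`, closing brackets at
those given by `v`, and elements of `K` given by `X`. -/
def transitionMatrix {K L ι κ : Type*} [Semiring K] [Semiring L] (f : K →+* L) (o c : Fin 2 → L)
    (u v : Matrix ι κ (Option (Fin 2))) (X : Matrix ι κ K) : Matrix ι κ L :=
  u.map (fun a => a.elim 0 o) + v.map (fun a => a.elim 0 c) + X.map f

/-- The matrix without brackets. -/
def noBracket (ι κ : Type*) : Matrix ι κ (Option (Fin 2)) := Matrix.of fun _ _ => none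

section transitionMatrix

variable {K L : Type*} [Semiring K] [Semiring L] (f : K →+* L) (o c : Fin 2 → L)

theorem transitionMatrix_noBracket {ι κ : Type*} (X : Matrix ι κ K) :
    transitionMatrix f o c (noBracket ι κ) (noBracket ι κ) X = X.map f := by
  ext i j
  simp [transitionMatrix, noBracket]

theorem transitionMatrix_fromBlocks {l m n k : Type*}
    (u₁ v₁ : Matrix l n (Option (Fin 2))) (u₂ v₂ : Matrix l k (Option (Fin 2)))
    (u₃ v₃ : Matrix m n (Option (Fin 2))) (u₄ v₄ : Matrix m k (Option (Fin 2)))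
    (X₁ : Matrix l n K) (X₂ : Matrix l k K) (X₃ : Matrix m n K) (X₄ : Matrix m k K) :
    transitionMatrix f o c (.fromBlocks u₁ u₂ u₃ u₄) (.fromBlocks v₁ v₂ v₃ v₄)
      (.fromBlocks X₁ X₂ X₃ X₄) =
    .fromBlocks (transitionMatrix f o c u₁ v₁ X₁) (transitionMatrix f o c u₂ v₂ X₂)
      (transitionMatrix f o c u₃ v₃ X₃) (transitionMatrix f o c u₄ v₄ X₄) := by
  simp only [transitionMatrix, Matrix.fromBlocks_map, Matrix.fromBlocks_add]

end transitionMatrix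

/-! ### Kleene's theorem: closure of recognizable elements -/

/-- `φ` is the behaviour `S A* F` of a finite automaton with transition matrix `A` over `K` and the
brackets `o`, `c`. -/
def IsRecognizable {K L : Type*} [RDioid K] [RDioid L] (f : K →+* L) (o c : Fin 2 → L)
    (φ : L) : Prop :=
  ∃ (ι : Type) (_ : Fintype ι) (_ : DecidableEq ι) (S : Matrix (Fin 1) ι K)
    (F : Matrix ι (Fin 1) K) (u v : Matrix ι ι (Option (Fin 2))) (X : Matrix ι ι K)
    (T : Matrix ι ι L), (∀ i j, S i j = 0 ∨ S i j = 1) ∧ (∀ i j, F i j = 0 ∨ F i j = 1) ∧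
      IsMatrixStar (transitionMatrix f o c u v X) T ∧
      S.map f * T * F.map f = Matrix.of fun _ _ => φ

section IsRecognizable

variable {K L : Type*} [RDioid K] [RDioid L] (f : K →+* L) (o c : Fin 2 → L)

/-- Two states joined by one edge: the transition matrix has square zero, so its iteration is `1 +
M`, with the label as its upper right entry. -/
theorem isRecognizable_of_transition (u v : Matrix (Fin 1) (Fin 1) (Option (Fin 2)))
    (X : Matrix (Fin 1) (Fin 1) K) (φ : L)
    (h : transitionMatrix f o c u v X = Matrix.of fun _ _ => φ) : IsRecognizable f o c φ := by
  let E : Matrix (Fin 1) (Fin 1) L := Matrix.of fun _ _ => φ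
  let z := noBracket (Fin 1) (Fin 1)
  refine ⟨Fin 1 ⊕ Fin 1, inferInstance, inferInstance, Matrix.fromCols 1 0, Matrix.fromRows 0 1,
    .fromBlocks z u z z, .fromBlocks z v z z, .fromBlocks 0 X 0 0,
    1 + .fromBlocks 0 E 0 0, ?_, ?_, ?_, ?_⟩
  · rintro i (j | j)
    · exact Or.inr (by simp [Subsingleton.elim i j])
    · exact Or.inl rfl
  · rintro (i | i) j
    · exact Or.inl rfl
    · exact Or.inr (by simp [Subsingleton.elim i j])
  · rw [transitionMatrix_fromBlocks, transitionMatrix_noBracket, h, Matrix.map_zero _ f.map_zero]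
    exact isMatrixStar_one_add (by simp [Matrix.fromBlocks_multiply])
  · rw [← Matrix.fromBlocks_one, Matrix.fromBlocks_add, Matrix.fromCols_map, Matrix.fromRows_map,
      Matrix.fromCols_mul_fromBlocks, Matrix.fromCols_mul_fromRows]
    simp [E]

theorem isRecognizable_coe (k : K) : IsRecognizable f o c (f k) :=
  isRecognizable_of_transition f o c (noBracket _ _) (noBracket _ _) (Matrix.of fun _ _ => k) _
    (transitionMatrix_noBracket f o c _)

theorem isRecognizable_opening (a : Fin 2) : IsRecognizable f o c (o a) :=
  isRecognizable_of_transition f o c (Matrix.of fun _ _ => some a) (noBracket _ _) 0 _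
    (by ext i j; simp [transitionMatrix, noBracket])

theorem isRecognizable_closing (a : Fin 2) : IsRecognizable f o c (c a) :=
  isRecognizable_of_transition f o c (noBracket _ _) (Matrix.of fun _ _ => some a) 0 _
    (by ext i j; simp [transitionMatrix, noBracket])

variable {f o c}

/-- The disjoint union of the two automata. -/
theorem IsRecognizable.add {φ ψ : L} (h₁ : IsRecognizable f o c φ) (h₂ : IsRecognizable f o c ψ) :
    IsRecognizable f o c (φ + ψ) := by
  obtain ⟨ι₁, _, _, S₁, F₁, u₁, v₁, X₁, T₁, hS₁, hF₁, hT₁, e₁⟩ := h₁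
  obtain ⟨ι₂, _, _, S₂, F₂, u₂, v₂, X₂, T₂, hS₂, hF₂, hT₂, e₂⟩ := h₂
  refine ⟨ι₁ ⊕ ι₂, inferInstance, inferInstance, Matrix.fromCols S₁ S₂, Matrix.fromRows F₁ F₂,
    .fromBlocks u₁ (noBracket _ _) (noBracket _ _) u₂,
    .fromBlocks v₁ (noBracket _ _) (noBracket _ _) v₂, .fromBlocks X₁ 0 0 X₂,
    .fromBlocks T₁ 0 0 T₂, ?_, ?_, ?_, ?_⟩
  · rintro i (j | j)
    exacts [hS₁ i j, hS₂ i j]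
  · rintro (i | i) j
    exacts [hF₁ i j, hF₂ i j]
  · rw [transitionMatrix_fromBlocks, transitionMatrix_noBracket, transitionMatrix_noBracket,
      Matrix.map_zero _ f.map_zero, Matrix.map_zero _ f.map_zero]
    simpa using isMatrixStar_fromBlocks (transitionMatrix f o c u₁ v₁ X₁) 0 0
      (transitionMatrix f o c u₂ v₂ X₂) T₁ T₂ hT₂ (by simpa using hT₁)
  · rw [Matrix.fromCols_map, Matrix.fromRows_map, Matrix.fromCols_mul_fromBlocks,
      Matrix.fromCols_mul_fromRows]
    simp only [Matrix.mul_zero, add_zero, zero_add, e₁, e₂]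
    rfl

/-- Final states of the first automaton are joined to initial states of the second by the edges `F₁
S₂`. Initial and final vectors are taken over `K` so that such edges are again entries of `X`. -/
theorem IsRecognizable.mul {φ ψ : L} (h₁ : IsRecognizable f o c φ) (h₂ : IsRecognizable f o c ψ) :
    IsRecognizable f o c (φ * ψ) := by
  obtain ⟨ι₁, _, _, S₁, F₁, u₁, v₁, X₁, T₁, hS₁, hF₁, hT₁, e₁⟩ := h₁
  obtain ⟨ι₂, _, _, S₂, F₂, u₂, v₂, X₂, T₂, hS₂, hF₂, hT₂, e₂⟩ := h₂
  refine ⟨ι₁ ⊕ ι₂, inferInstance, inferInstance, Matrix.fromCols S₁ 0, Matrix.fromRows 0 F₂,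
    .fromBlocks u₁ (noBracket _ _) (noBracket _ _) u₂,
    .fromBlocks v₁ (noBracket _ _) (noBracket _ _) v₂, .fromBlocks X₁ (F₁ * S₂) 0 X₂,
    .fromBlocks T₁ (T₁ * (F₁.map f * S₂.map f) * T₂) 0 T₂, ?_, ?_, ?_, ?_⟩
  · rintro i (j | j)
    exacts [hS₁ i j, Or.inl rfl]
  · rintro (i | i) j
    exacts [Or.inl rfl, hF₂ i j]
  · rw [transitionMatrix_fromBlocks, transitionMatrix_noBracket, transitionMatrix_noBracket,
      Matrix.map_zero _ f.map_zero, Matrix.map_mul]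
    simpa using isMatrixStar_fromBlocks (transitionMatrix f o c u₁ v₁ X₁) (F₁.map f * S₂.map f) 0
      (transitionMatrix f o c u₂ v₂ X₂) T₁ T₂ hT₂ (by simpa using hT₁)
  · rw [Matrix.fromCols_map, Matrix.fromRows_map, Matrix.fromCols_mul_fromBlocks,
      Matrix.fromCols_mul_fromRows]
    have h : S₁.map f * (T₁ * (F₁.map f * S₂.map f) * T₂) * F₂.map f =
        (S₁.map f * T₁ * F₁.map f) * (S₂.map f * T₂ * F₂.map f) := by
      simp only [Matrix.mul_assoc]
    simp only [Matrix.map_zero _ f.map_zero, Matrix.mul_zero, Matrix.zero_mul, add_zero, zero_add,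
      h, e₁, e₂]
    ext i j
    simp [Matrix.mul_apply]

/-- A new state, both initial and final, is joined to the automaton by `S` and from it by `F`. The
first return to it contributes `S T F = φ`, so its diagonal entry in the iteration is `φ*`. -/
theorem IsRecognizable.kstar {φ : L} (h : IsRecognizable f o c φ) :
    IsRecognizable f o c (KStar.kstar φ) := by
  obtain ⟨ι, _, _, S, F, u, v, X, T, hS, hF, hT, e⟩ := h
  have hstar := isMatrixStar_fromBlocks 0 (S.map f) (F.map f) (transitionMatrix f o c u v X)
    ((Matrix.of fun _ _ => φ).map KStar.kstar) T hT
    (by rw [zero_add, e]; exact isMatrixStar_one_by_one _)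
  refine ⟨Fin 1 ⊕ ι, inferInstance, inferInstance, Matrix.fromCols 1 0, Matrix.fromRows 1 0,
    .fromBlocks (noBracket _ _) (noBracket _ _) (noBracket _ _) u,
    .fromBlocks (noBracket _ _) (noBracket _ _) (noBracket _ _) v, .fromBlocks 0 S F X,
    .fromBlocks _ _ _ _, ?_, ?_,
    (by
      rw [transitionMatrix_fromBlocks, transitionMatrix_noBracket, transitionMatrix_noBracket,
        transitionMatrix_noBracket, Matrix.map_zero _ f.map_zero]
      exact hstar), ?_⟩
  · rintro i (j | j)
    · exact Or.inr (by simp [Subsingleton.elim i j])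
    · exact Or.inl rfl
  · rintro (i | i) j
    · exact Or.inr (by simp [Subsingleton.elim i j])
    · exact Or.inl rfl
  · rw [Matrix.fromCols_map, Matrix.fromRows_map, Matrix.fromCols_mul_fromBlocks,
      Matrix.fromCols_mul_fromRows]
    ext i j
    simp [Matrix.map_zero _ f.map_zero]

/-- The state set of an automaton can be taken to be `Fin n`. -/
theorem IsRecognizable.exists_fin {φ : L} (h : IsRecognizable f o c φ) :
    ∃ (n : ℕ) (S : Matrix (Fin 1) (Fin n) K) (F : Matrix (Fin n) (Fin 1) K)
      (u v : Matrix (Fin n) (Fin n) (Option (Fin 2))) (X : Matrix (Fin n) (Fin n) K),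
      (∀ i j, S i j = 0 ∨ S i j = 1) ∧ (∀ i j, F i j = 0 ∨ F i j = 1) ∧
      S.map f * KStar.kstar (transitionMatrix f o c u v X) * F.map f = Matrix.of fun _ _ => φ := by
  obtain ⟨ι, _, _, S, F, u, v, X, T, hS, hF, hT, e⟩ := h
  let g := Fintype.equivFin ι
  refine ⟨Fintype.card ι, S.submatrix id g.symm, F.submatrix g.symm id, u.submatrix g.symm g.symm,
    v.submatrix g.symm g.symm, X.submatrix g.symm g.symm, fun i j => hS _ _, fun i j => hF _ _, ?_⟩
  have hT' : IsMatrixStar ((transitionMatrix f o c u v X).submatrix g.symm g.symm)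
      (T.submatrix g.symm g.symm) :=
    isMatrixStar_submatrix g _ T (by simpa using hT)
  have hT'' := hT'.unique (isMatrixStar_matrixStar _ _)
  change (S.map f).submatrix id g.symm * matrixStar _
    ((transitionMatrix f o c u v X).submatrix g.symm g.symm) * (F.map f).submatrix g.symm id = _
  rw [← hT'', Matrix.submatrix_mul_equiv, Matrix.submatrix_mul_equiv, e]
  rfl

end IsRecognizable

/-! ## Balanced runs -/

/-- `BalancedRun u v X i j k`: the automaton has a run from `i` to `j` whose bracket sequence is
balanced and whose product in `K` is `k`. -/
inductive BalancedRun {K ι : Type*} [Semiring K] (u v : Matrix ι ι (Option (Fin 2)))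
    (X : Matrix ι ι K) : ι → ι → K → Prop
  | one (i) : BalancedRun u v X i i 1
  | mul {i j l k k'} : BalancedRun u v X i j k → BalancedRun u v X j l k' →
      BalancedRun u v X i l (k * k')
  | coe (i j) : BalancedRun u v X i j (X i j)
  | bracket {i j l m a k} : u i j = some a → BalancedRun u v X j l k → v l m = some a →
      BalancedRun u v X i m k

/-- `OpenRun u v X i j s k`: a run from `i` to `j` that leaves the stack `s` of brackets open, with
product `k` in `K`. -/
inductive OpenRun {K ι : Type*} [Semiring K] (u v : Matrix ι ι (Option (Fin 2)))
    (X : Matrix ι ι K) : ι → ι → List (Fin 2) → K → Prop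
  | balanced {i j k} : BalancedRun u v X i j k → OpenRun u v X i j [] k
  | push {i j l m s k k' a} : OpenRun u v X i j s k → u j l = some a →
      BalancedRun u v X l m k' → OpenRun u v X i m (a :: s) (k * k')

section Run

variable {K ι : Type*} [Semiring K] {u v : Matrix ι ι (Option (Fin 2))} {X : Matrix ι ι K}

theorem OpenRun.mul_balanced {i j l : ι} {s : List (Fin 2)} {k k' : K}
    (h : OpenRun u v X i j s k) (h' : BalancedRun u v X j l k') :
    OpenRun u v X i l s (k * k') := by
  cases h with
  | balanced h => exact .balanced (h.mul h')
  | push h hu hb => rw [mul_assoc]; exact .push h hu (hb.mul h')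

end Run

/-! ### Sums of balanced runs by means of end markers -/

/-- Two pairs of brackets `P`, `Q` with end markers `β`, `δ` in `L`; the opening ones commute
with the image of `K`. -/
structure MarkedBrackets {K L : Type*} [Semiring K] [Semiring L] (f : K →+* L) (P Q : Fin 2 → L)
    (β δ : L) : Prop where
  mul_eq : ∀ a, P a * Q a = 1
  mul_ne : ∀ a a', a ≠ a' → P a * Q a' = 0
  marker : β * δ = 1
  left : ∀ a, β * Q a = 0
  right : ∀ a, P a * δ = 0
  commute_open : ∀ k a, Commute (f k) (P a)
  commute_left : ∀ k, Commute (f k) β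

section MarkedBrackets

variable {K L : Type*} [RDioid K] [RDioid L] {f : K →+* L} {P Q : Fin 2 → L} {β δ : L}
  {n : ℕ} {u v : Matrix (Fin n) (Fin n) (Option (Fin 2))} {X : Matrix (Fin n) (Fin n) K}

theorem le_transitionMatrix_of_opening {ι : Type*} {u v : Matrix ι ι (Option (Fin 2))}
    {X : Matrix ι ι K} {i j : ι} {a : Fin 2} (h : u i j = some a) :
    P a ≤ transitionMatrix f P Q u v X i j := by
  simp [transitionMatrix, h, add_assoc]

theorem le_transitionMatrix_of_closing {ι : Type*} {u v : Matrix ι ι (Option (Fin 2))}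
    {X : Matrix ι ι K} {i j : ι} {a : Fin 2} (h : v i j = some a) :
    Q a ≤ transitionMatrix f P Q u v X i j := by
  simp only [transitionMatrix, Matrix.add_apply, Matrix.map_apply, h, Option.elim_some]
  exact (add_le_iff.1 (add_le_iff.1 le_rfl).1).2

theorem le_transitionMatrix_coe {ι : Type*} {u v : Matrix ι ι (Option (Fin 2))}
    {X : Matrix ι ι K} (i j : ι) : f (X i j) ≤ transitionMatrix f P Q u v X i j := by
  simp [transitionMatrix]

theorem matrix_mul_apply_le {l m n : Type*} [Fintype m] (M : Matrix l m L) (M' : Matrix m n L)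
    (i : l) (j : m) (k : n) : M i j * M' j k ≤ (M * M') i k := by
  rw [Matrix.mul_apply]
  exact Finset.single_le_sum (f := fun j => M i j * M' j k) (fun _ _ => zero_le)
    (Finset.mem_univ j)

theorem matrix_mul_le_iff {l m n : Type*} [Fintype m] {M : Matrix l m L} {M' : Matrix m n L}
    {i : l} {k : n} {z : L} : (M * M') i k ≤ z ↔ ∀ j, M i j * M' j k ≤ z := by
  refine ⟨fun h j => (matrix_mul_apply_le M M' i j k).trans h, fun h => ?_⟩
  rw [Matrix.mul_apply]
  exact Finset.sum_induction _ (· ≤ z) (fun _ _ => add_le) zero_le fun j _ => h j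

/-- A matrix that is reflexive, transitive, above `X` and closed under matching brackets is above
all balanced runs. -/
theorem BalancedRun.le_of_closed (hPQ : ∀ a, P a * Q a = 1) (hc : ∀ k a, Commute (f k) (P a))
    {M : Matrix (Fin n) (Fin n) L} (h1 : 1 ≤ M) (hM : M * M ≤ M) (hX : X.map f ≤ M)
    (hUV : ∀ i j l m a, u i j = some a → v l m = some a → P a * M j l * Q a ≤ M i m)
    {i j : Fin n} {k : K} (h : BalancedRun u v X i j k) : f k ≤ M i j := by
  induction h with
  | one i => simpa using h1 i i
  | mul _ _ h₁ h₂ =>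
    rw [map_mul]
    exact (mul_le_mul' h₁ h₂).trans ((matrix_mul_apply_le _ _ _ _ _).trans (hM _ _))
  | coe i j => exact hX i j
  | @bracket i j l m a k hu _ hv ih =>
    refine le_trans ?_ (hUV _ _ _ _ a hu hv)
    -- A matching pair is inserted as `1`, and its opening half is moved across `k`.
    calc f k = f k * (P a * Q a) := by rw [hPQ, mul_one]
      _ = P a * f k * Q a := by rw [← mul_assoc, (hc k a).eq]
      _ ≤ _ := mul_le_mul' (mul_le_mul' le_rfl ih) le_rfl

/-- The product of the open brackets of a stack, the innermost one last. -/
def stackProd (P : Fin 2 → L) : List (Fin 2) → L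
  | [] => 1
  | a :: s => stackProd P s * P a

variable (f P Q β δ u v X) in
/-- `β A* δ`, for the transition matrix `A` with brackets `P`, `Q`. -/
noncomputable def balancedMatrix : Matrix (Fin n) (Fin n) L :=
  (KStar.kstar (transitionMatrix f P Q u v X)).map fun z => β * z * δ

namespace MarkedBrackets

variable (hB : MarkedBrackets f P Q β δ)
include hB

theorem commute_stackProd (k : K) (s : List (Fin 2)) : Commute (f k) (stackProd P s) := by
  induction s with
  | nil => exact Commute.one_right _
  | cons a s ih => exact ih.mul_right (hB.commute_open k a)

/-- The iteration of `A` has all the closure properties of balanced runs, so it lies above `k`; the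
markers then cancel, since `β k δ = k β δ = k`. -/
theorem le_balancedMatrix {i j : Fin n} {k : K} (h : BalancedRun u v X i j k) :
    f k ≤ balancedMatrix f P Q β δ u v X i j := by
  set A := transitionMatrix f P Q u v X with hA
  have hle : A ≤ KStar.kstar A := le_kstar
  have hss : KStar.kstar A * KStar.kstar A ≤ KStar.kstar A := (kstar_mul_kstar A).le
  have key : f k ≤ KStar.kstar A i j := by
    refine h.le_of_closed hB.mul_eq hB.commute_open one_le_kstar hss
      (fun i j => (le_transitionMatrix_coe i j).trans (hle i j)) fun i j l m a hu hv => ?_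
    calc P a * KStar.kstar A j l * Q a
        ≤ KStar.kstar A i j * KStar.kstar A j l * KStar.kstar A l m :=
          mul_le_mul' (mul_le_mul' ((le_transitionMatrix_of_opening hu).trans (hle i j)) le_rfl)
            ((le_transitionMatrix_of_closing hv).trans (hle l m))
      _ ≤ KStar.kstar A i l * KStar.kstar A l m :=
          mul_le_mul' ((matrix_mul_apply_le _ _ _ _ _).trans (hss _ _)) le_rfl
      _ ≤ KStar.kstar A i m := (matrix_mul_apply_le _ _ _ _ _).trans (hss _ _)
  calc f k = β * f k * δ := by rw [← (hB.commute_left k).eq, mul_assoc, hB.marker, mul_one]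
    _ ≤ _ := mul_le_mul' (mul_le_mul' le_rfl key) le_rfl

/-- The sets record what a run from `i₀` reduces to after the marker `β`: a value in `K` and a stack
of open brackets. Each transition leads to another such element or to zero. Since these sets are
infinite and not known to have suprema, the invariant speaks of their upper bounds. -/
theorem transitionMatrix_mem_mulLeSet (i₀ : Fin n) (x : L) (j l : Fin n) :
    transitionMatrix f P Q u v X j l ∈
      mulLeSet (fun j => {w | ∃ s k, OpenRun u v X i₀ j s k ∧ w = x * β * f k * stackProd P s})
        j l := by
  rintro y z h _ ⟨s, k, hr, rfl⟩
  simp only [transitionMatrix, Matrix.add_apply, Matrix.map_apply, mul_add, add_mul]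
  refine add_le (add_le ?_ ?_) ?_
  · cases hu : u j l with
    | none => simp
    | some a =>
      refine le_trans (le_of_eq ?_) (h _ ⟨_, _, hr.push hu (.one l), rfl⟩)
      simp only [stackProd, Option.elim_some, mul_one, mul_assoc]
  · cases hv : v j l with
    | none => simp
    | some a =>
      cases hr with
      | balanced hr =>
        -- On the empty stack, a closing bracket meets the marker: `β` is moved across `k` and `β Q
        -- = 0`.
        rw [Option.elim_some, stackProd, mul_one, mul_assoc x, ← (hB.commute_left k).eq,
          mul_assoc, mul_assoc, mul_assoc, ← mul_assoc β, hB.left]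
        simp
      | @push _ _ _ s k₁ k₂ a' hr hu hb =>
        rw [Option.elim_some, stackProd]
        -- On a nonempty stack the top bracket either matches, which closes a balanced run, or gives
        -- `P Q = 0`.
        by_cases ha : a' = a
        · subst ha
          refine le_trans (le_of_eq ?_) (h _ ⟨_, _, hr.mul_balanced (.bracket hu hb hv), rfl⟩)
          simp only [mul_assoc]
          rw [← mul_assoc (P a'), hB.mul_eq, one_mul]
        · simp only [mul_assoc]
          rw [← mul_assoc (P a'), hB.mul_ne _ _ ha]
          simp
  · refine le_trans (le_of_eq ?_) (h _ ⟨_, _, hr.mul_balanced (.coe j l), rfl⟩)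
    rw [map_mul, mul_assoc _ _ (f (X j l)), ← (hB.commute_stackProd _ s).eq]
    simp only [mul_assoc]

/-- The entries of `β A* δ` are the suprema of the balanced runs, and these suprema are preserved
by multiplication from either side. -/
theorem mul_balancedMatrix_mul_le {i j : Fin n} {x y z : L}
    (h : ∀ k, BalancedRun u v X i j k → x * f k * y ≤ z) :
    x * balancedMatrix f P Q β δ u v X i j * y ≤ z := by
  -- The invariant starts from the empty run at `i` with empty stack, represented by `x β`, and the
  -- right marker is made part of the right factor `δ y`.
  have key := matrixStar_mem_mulLeSet (M := transitionMatrix f P Q u v X)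
    (hB.transitionMatrix_mem_mulLeSet i x) i j (δ * y) z ?_ (x * β)
    ⟨[], 1, .balanced (.one i), by simp [stackProd]⟩
  · simpa only [balancedMatrix, Matrix.map_apply, mul_assoc] using key
  · rintro _ ⟨s, k, hr, rfl⟩
    cases hr with
    | balanced hr =>
      refine le_trans (le_of_eq ?_) (h k hr)
      rw [stackProd, mul_one, mul_assoc x, ← (hB.commute_left k).eq]
      simp only [mul_assoc]
      rw [← mul_assoc β, hB.marker, one_mul]
    | @push _ _ _ s k₁ k₂ a hr hu hb =>
      -- A bracket left open at the end is annihilated by the right marker.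
      rw [stackProd, ← mul_assoc, ← mul_assoc, mul_assoc _ (P a) δ, hB.right]
      simp

theorem balancedMatrix_apply_le {i j : Fin n} {z : L}
    (h : ∀ k, BalancedRun u v X i j k → f k ≤ z) : balancedMatrix f P Q β δ u v X i j ≤ z := by
  simpa using hB.mul_balancedMatrix_mul_le (x := 1) (y := 1) (z := z) (by simpa using h)

/-- Multiplication by `e` on either side preserves the suprema of balanced values, so it is enough
that `e` commutes with `K`. -/
theorem commute_balancedMatrix {e : L} (he : ∀ k, Commute (f k) e) (i j : Fin n) :
    Commute (balancedMatrix f P Q β δ u v X i j) e := by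
  apply le_antisymm
  · simpa using hB.mul_balancedMatrix_mul_le (x := 1) (y := e) fun k hk => by
      rw [one_mul, (he k).eq]
      exact mul_le_mul' le_rfl (hB.le_balancedMatrix hk)
  · simpa using hB.mul_balancedMatrix_mul_le (x := e) (y := 1) fun k hk => by
      rw [mul_one, ← (he k).eq]
      exact mul_le_mul' (hB.le_balancedMatrix hk) le_rfl

theorem one_le_balancedMatrix : 1 ≤ balancedMatrix f P Q β δ u v X := fun i j => by
  rw [Matrix.one_apply]
  split_ifs with h
  · subst h
    exact (map_one f).symm.le.trans (hB.le_balancedMatrix (.one i))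
  · exact zero_le

/-- The supremum property is used once for each factor, which leaves the concatenation of two
balanced runs. -/
theorem balancedMatrix_mul_self_le :
    balancedMatrix f P Q β δ u v X * balancedMatrix f P Q β δ u v X ≤
      balancedMatrix f P Q β δ u v X := fun i l => by
  refine matrix_mul_le_iff.2 fun j => ?_
  simpa using hB.mul_balancedMatrix_mul_le (x := 1) fun k hk => by
    rw [one_mul]
    simpa using hB.mul_balancedMatrix_mul_le (x := f k) (y := 1) fun k' hk' => by
      rw [mul_one, ← map_mul]
      exact hB.le_balancedMatrix (hk.mul hk')

theorem coe_le_balancedMatrix : X.map f ≤ balancedMatrix f P Q β δ u v X :=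
  fun i j => hB.le_balancedMatrix (.coe i j)

variable {o c : Fin 2 → L} (hoc : ∀ a a', o a * c a' = if a = a' then 1 else 0)
  (ho : ∀ k a, Commute (f k) (o a))
include hoc ho

/-- Here the original brackets `o`, `c` surround a matrix that was formed with the recoded ones. On
a single value, `o a' k c a = k (o a' c a)` is either zero or the value of a longer balanced run, so
the coding no longer matters. -/
theorem bracket_balancedMatrix_le :
    u.map (fun a => a.elim 0 o) * balancedMatrix f P Q β δ u v X * v.map (fun a => a.elim 0 c) ≤
      balancedMatrix f P Q β δ u v X := fun i m => by
  refine matrix_mul_le_iff.2 fun l => ?_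
  suffices h : ∀ a, v l m = some a →
      (u.map (fun a => a.elim 0 o) * balancedMatrix f P Q β δ u v X) i l * c a ≤
        balancedMatrix f P Q β δ u v X i m by
    cases hv : v l m with
    | none => simp [hv]
    | some a => simpa [hv] using h a hv
  intro a hv
  rw [Matrix.mul_apply, Finset.sum_mul]
  refine Finset.sum_induction _ (· ≤ _) (fun _ _ => add_le) zero_le fun j _ => ?_
  cases hu : u i j with
  | none => simp [hu]
  | some a' =>
    rw [Matrix.map_apply, hu, Option.elim_some]
    refine hB.mul_balancedMatrix_mul_le fun k hk => ?_
    rw [← (ho k a').eq, mul_assoc, hoc]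
    split_ifs with h
    · subst h
      rw [mul_one]
      exact hB.le_balancedMatrix (.bracket hu hk hv)
    · simp

/-- `β A* δ` is the least solution of `y ≥ (U y V + X)*`. -/
theorem isLeast_balancedMatrix :
    IsLeast {Y : Matrix (Fin n) (Fin n) L |
      KStar.kstar (u.map (fun a => a.elim 0 o) * Y * v.map (fun a => a.elim 0 c) + X.map f) ≤ Y}
      (balancedMatrix f P Q β δ u v X) := by
  constructor
  · refine kstar_le_of_mul_le_left hB.one_le_balancedMatrix ?_
    refine (matrix_mul_mono le_rfl (matrix_add_le ?_ hB.coe_le_balancedMatrix)).trans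
      hB.balancedMatrix_mul_self_le
    exact hB.bracket_balancedMatrix_le hoc ho
  · intro Y hY
    set U := u.map (fun a => a.elim 0 o) with hU
    set V := v.map (fun a => a.elim 0 c) with hV
    set M := KStar.kstar (U * Y * V + X.map f) with hM
    -- The runs are bounded by `M = (U Y V + X)*`, not directly by `Y`: `M` is transitive, which is
    -- not known of `Y`. Closure of `M` under brackets comes from `M ≤ Y`.
    refine le_trans (fun i j => hB.balancedMatrix_apply_le fun k hk => ?_) hY
    have hle : U * Y * V + X.map f ≤ M := le_kstar
    rw [matrix_add_le_iff] at hle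
    refine hk.le_of_closed (fun a => by rw [hoc, if_pos rfl]) ho one_le_kstar
      (kstar_mul_kstar _).le hle.2 fun i j l m a hu hv => ?_
    calc o a * M j l * c a ≤ U i j * Y j l * V l m := by
          have e₁ : U i j = o a := by simp [hU, hu]
          have e₂ : V l m = c a := by simp [hV, hv]
          rw [e₁, e₂]
          exact mul_le_mul' (mul_le_mul' le_rfl (hY j l)) le_rfl
      _ ≤ (U * Y * V) i m :=
          (mul_le_mul' (matrix_mul_apply_le U Y i j l) le_rfl).trans (matrix_mul_apply_le _ _ _ _ _)
      _ ≤ M i m := hle.1 i m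

/-- The bracketing normal form of `A*`. -/
theorem kstar_transitionMatrix_eq :
    KStar.kstar (transitionMatrix f o c u v X) =
      KStar.kstar (balancedMatrix f P Q β δ u v X * v.map (fun a => a.elim 0 c)) *
        balancedMatrix f P Q β δ u v X *
        KStar.kstar (u.map (fun a => a.elim 0 o) * balancedMatrix f P Q β δ u v X) := by
  refine kstar_add_eq_of_bracket hB.one_le_balancedMatrix hB.balancedMatrix_mul_self_le
    hB.coe_le_balancedMatrix (hB.bracket_balancedMatrix_le hoc ho) ?_
  -- `A*` itself solves the inequation, so it lies above the least solution.
  refine (hB.isLeast_balancedMatrix hoc ho).2 ?_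
  have hle : transitionMatrix f o c u v X ≤ KStar.kstar (transitionMatrix f o c u v X) := le_kstar
  have hle' := hle
  rw [transitionMatrix, matrix_add_le_iff, matrix_add_le_iff] at hle'
  have hss := (kstar_mul_kstar (transitionMatrix f o c u v X)).le
  refine kstar_le_of_mul_le_left one_le_kstar ((matrix_mul_mono le_rfl ?_).trans hss)
  exact matrix_add_le
    ((matrix_mul_mono ((matrix_mul_mono hle'.1.1 le_rfl).trans hss) hle'.1.2).trans hss) hle'.2

end MarkedBrackets

end MarkedBrackets

/-! ## The first normal form -/

/-- In `C₂'`, the pairs `b p, q d` and `p p, q q` behave like matching brackets with respect to the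
end markers `b`, `d`. -/
theorem markedBrackets_of_brackets {K L : Type*} [Semiring K] [Semiring L] {f : K →+* L}
    {o c : Fin 2 → L} (hoc : ∀ a a', o a * c a' = if a = a' then 1 else 0)
    (ho : ∀ k a, Commute (f k) (o a)) :
    MarkedBrackets f (fun a => o a * o 1) (fun a => c 1 * c a) (o 0) (c 0) where
  mul_eq a := by
    rw [mul_assoc, ← mul_assoc (o 1), hoc, if_pos rfl, one_mul, hoc, if_pos rfl]
  mul_ne a a' h := by
    rw [mul_assoc, ← mul_assoc (o 1), hoc, if_pos rfl, one_mul, hoc, if_neg h]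
  marker := by rw [hoc, if_pos rfl]
  left a := by rw [← mul_assoc, hoc, if_neg (by decide), zero_mul]
  right a := by rw [mul_assoc, hoc, if_neg (by decide), mul_zero]
  commute_open k a := (ho k a).mul_right (ho k 1)
  commute_left k := ho k 0

/-- First Normal Form. Here `b, p` are the opening and `d, q` the closing brackets of `C₂'`,
and `U`, `V`, `X` are read in `K ⊗_ℛ C₂'` through the canonical maps. -/
theorem mainTheorem1 {K : Type*} [RDioid K] (φ : RTensor K (Polycyclic 2)) :
    ∃ (n : ℕ) (S : Matrix (Fin 1) (Fin n) (RTensor K (Polycyclic 2)))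
      (F : Matrix (Fin n) (Fin 1) (RTensor K (Polycyclic 2)))
      (U V : Matrix (Fin n) (Fin n) (Polycyclic 2)) (X : Matrix (Fin n) (Fin n) K)
      (N : Matrix (Fin n) (Fin n) (RTensor K (Polycyclic 2))),
      (∀ i j, S i j = 0 ∨ S i j = 1) ∧
      (∀ i j, F i j = 0 ∨ F i j = 1) ∧
      (∀ i j, U i j = 0 ∨ U i j = Polycyclic.opening 0 ∨ U i j = Polycyclic.opening 1) ∧
      (∀ i j, V i j = 0 ∨ V i j = Polycyclic.closing 0 ∨ V i j = Polycyclic.closing 1) ∧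
      IsLeast {Y : Matrix (Fin n) (Fin n) (RTensor K (Polycyclic 2)) |
        KStar.kstar (U.map RTensor.inr * Y * V.map RTensor.inr + X.map RTensor.inl) ≤ Y} N ∧
      (∀ i j, N i j ∈ tensorCentralizer K (Polycyclic 2)) ∧
      Matrix.of (fun _ _ => φ) =
        S * KStar.kstar (N * V.map RTensor.inr) * N * KStar.kstar (U.map RTensor.inr * N) * F := by
  let f := RTensor.inlHom K (Polycyclic 2)
  let g := RTensor.inrHom K (Polycyclic 2)
  let o : Fin 2 → RTensor K (Polycyclic 2) := fun a => g (Polycyclic.opening a)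
  let c : Fin 2 → RTensor K (Polycyclic 2) := fun a => g (Polycyclic.closing a)
  have hoc : ∀ a a', o a * c a' = if a = a' then 1 else 0 := fun a a' => by
    rw [← map_mul, Polycyclic.opening_mul_closing, apply_ite g, map_one, map_zero]
  have ho : ∀ k a, Commute (f k) (o a) := fun k a => RTensor.commute_inl_inr k _
  have hB := markedBrackets_of_brackets hoc ho
  have hφ : IsRecognizable f o c φ :=
    RTensor.induction_polycyclic (p := IsRecognizable f o c) (isRecognizable_coe f o c)
      (isRecognizable_opening f o c) (isRecognizable_closing f o c) (fun _ _ => .add)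
      (fun _ _ => .mul) (fun _ => .kstar) φ
  obtain ⟨n, S, F, u, v, X, hS, hF, e⟩ := hφ.exists_fin
  have hmap (w : Matrix (Fin n) (Fin n) (Option (Fin 2))) (z : Fin 2 → Polycyclic 2) :
      (w.map fun a => a.elim 0 z).map RTensor.inr = w.map fun a => a.elim 0 fun i => g (z i) := by
    ext i j
    cases h : w i j with
    | none => simp only [Matrix.map_apply, h, Option.elim_none]; exact map_zero g
    | some a => simp only [Matrix.map_apply, h, Option.elim_some]; rfl
  refine ⟨n, S.map f, F.map f, u.map fun a => a.elim 0 Polycyclic.opening,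
    v.map fun a => a.elim 0 Polycyclic.closing, X,
    balancedMatrix f (fun a => o a * o 1) (fun a => c 1 * c a) (o 0) (c 0) u v X,
    fun i j => ?_, fun i j => ?_, fun i j => ?_, fun i j => ?_, ?_, fun i j z => ?_, ?_⟩
  · exact (hS i j).imp (fun h => by simp [h]) (fun h => by simp [h])
  · exact (hF i j).imp (fun h => by simp [h]) (fun h => by simp [h])
  · rw [Matrix.map_apply]
    rcases u i j with _ | a
    · exact Or.inl rfl
    · fin_cases a
      exacts [Or.inr (Or.inl rfl), Or.inr (Or.inr rfl)]
  · rw [Matrix.map_apply]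
    rcases v i j with _ | a
    · exact Or.inl rfl
    · fin_cases a
      exacts [Or.inr (Or.inl rfl), Or.inr (Or.inr rfl)]
  · rw [hmap, hmap]
    exact hB.isLeast_balancedMatrix hoc ho
  · exact hB.commute_balancedMatrix (fun k => RTensor.commute_inl_inr k z) i j
  · rw [hmap, hmap, ← e, hB.kstar_transitionMatrix_eq hoc ho]
    simp only [Matrix.mul_assoc]
    rfl
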